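/- Work over $\mathbb{C}$ and let $n\geq 0$. Let $\Gamma$ be the set of subsets $I\subseteq\{1,\dots,n\}$ of even cardinality, $\Delta=\mathbb{C}^{\Gamma}$, and for a skew-symmetric $n\times n$ matrix $A$ let $\alpha(A)=(\mathrm{Pf}(A_I))_{I\in\Gamma}\in\Delta$, where $A_I$ is the principal submatrix of $A$ with rows and columns in $I$ (so $\mathrm{Pf}(A_\varnothing)=1$). The Spinor variety $\mathcal{S}_n\subset\mathbb{P}(\Delta)$ in its Spinor embedding is the Zariski closure of $\{[\alpha(A)] : A^{t}=-A\}$. For a smooth point $p$ of a variety $X\subset\mathbb{P}(\Delta)$ the $s$-th osculating space $T_p^sX$ is the linear span of the partial derivatives of order at most $s$ at $0$ of a local parametrization of $X$ at $p$ (written in homogeneous coordinates). A rational normal curve of degree $d$ is a map $\gamma:\mathbb{P}^1\to\mathbb{P}(\Delta)$, $[x:y]\mapsto[\sum_{j=0}^{d}x^{d-j}y^jc_j]$ with $c_0,\dots,c_d\in\Delta$ linearly independent; write $\gamma(t)=\gamma([1:t])$ and $\gamma(\infty)=\gamma([0:1])$. (1) Let $p,q\in\mathcal{S}_n$ be general points,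 that is, let $(p,q)$ lie in a suitable non-empty Zariski open subset of $\mathcal{S}_n\times\mathcal{S}_n$. Then there is a rational normal curve $\gamma:\mathbb{P}^1\to\mathcal{S}_n$ of degree $\lfloor n/2\rfloor$ such that $\gamma(0)=p$, $\gamma(\infty)=q$ and, for all integers $s_1,s_2\geq 0$, the family of linear spaces $T_t=\langle T_p^{s_1}\mathcal{S}_n,T_{\gamma(t)}^{s_2}\mathcal{S}_n\rangle$, $t\neq 0$, has a flat limit $T_0$ in the Grassmannian at $t=0$, and $$T_0\subseteq T_p^{s_1+s_2+1}\mathcal{S}_n.$$ That is, $\mathcal{S}_n\subset\mathbb{P}(\Delta)$ has strong $2$-osculating regularity. (2) For every skew-symmetric $n\times n$ matrix $A$ of rank $2\lfloor n/2\rfloor$ the map $t\mapsto[\alpha(tA)]$ extends to a rational normal curve $\gamma:\mathbb{P}^1\to\mathcal{S}_n$ of degree $\lfloor n/2\rfloor$, and with $p=\gamma(0)=[\alpha(0)]$ the same conclusion holds: for all $s_1,s_2\geq 0$ the flat limit $T_0$ at $t=0$ of $\langle T_p^{s_1}\mathcal{S}_n,T_{\gamma(t)}^{s_2}\mathcal{S}_n\rangle$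 exists and is contained in $T_p^{s_1+s_2+1}\mathcal{S}_n$. -/

import Mathlib

open scoped LinearAlgebra.Projectivization Topology

noncomputable section

namespace SpinorVariety

/-! ### Projective geometry over `ℂ` -/

section Projective

variable {E : Type*} [NormedAddCommGroup E] [NormedSpace ℂ E]

/-- The punctured affine cone over a subset of a projective space. -/
def affineCone (X : Set (ℙ ℂ E)) : Set E :=
  {x | ∃ hx : x ≠ 0, Projectivization.mk ℂ x hx ∈ X}

/-- `φ`, defined near the origin of `ℂ ^ d` and written in homogeneous coordinates, is a local
parametrization of `X ⊆ ℙ(E)` at `p`: it is holomorphic, takes the origin to `p` and points near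
the origin into `X`, its composition with the projection to `ℙ(E)` is an immersion at the origin
(the tangent space of `ℙ(E)` at `p` being `E ⧸ ℂ ∙ φ 0` up to a twist), and it sends neighbourhoods
of the origin onto neighbourhoods of `p` in `X`. -/
structure IsLocalParametrization (X : Set (ℙ ℂ E)) (p : ℙ ℂ E) {d : ℕ}
    (φ : (Fin d → ℂ) → E) : Prop where
  analytic : AnalyticAt ℂ φ 0
  base_eq : p.submodule = Submodule.span ℂ {φ 0}
  mem_cone : ∀ᶠ u in 𝓝 (0 : Fin d → ℂ), φ u ∈ affineCone X
  immersion : ∀ v : Fin d → ℂ, fderiv ℂ φ 0 v ∈ Submodule.span ℂ {φ 0} → v = 0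
  nhds_image : ∀ U ∈ 𝓝 (0 : Fin d → ℂ),
    {x : E | ∃ c : ℂ, ∃ u ∈ U, x = c • φ u} ∈ 𝓝[affineCone X] (φ 0)

/-- The `s`-th osculating space of `X` at `p`, as a linear subspace of `E`: it is spanned by the
derivatives of order at most `s` at the origin of a local parametrization of `X` at `p`. (The span
does not depend on the local parametrization; all of them are used so as not to choose one.) -/
def osculatingSpace (X : Set (ℙ ℂ E)) (p : ℙ ℂ E) (s : ℕ) : Submodule ℂ E :=
  Submodule.span ℂ {w | ∃ (d : ℕ) (φ : (Fin d → ℂ) → E), IsLocalParametrization X p φ ∧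
    ∃ k ≤ s, ∃ v : Fin k → (Fin d → ℂ), w = iteratedFDeriv ℂ k φ 0 v}

/-- The projective line. -/
abbrev P1 : Type := ℙ ℂ (Fin 2 → ℂ)

/-- The point `t = [1 : t]` of the affine part of the projective line. -/
def P1.ofAffine (t : ℂ) : P1 :=
  Projectivization.mk ℂ ![1, t] (fun h => one_ne_zero (congrFun h 0))

/-- The point `∞ = [0 : 1]` of the projective line. -/
def P1.infty : P1 :=
  Projectivization.mk ℂ ![0, 1] (fun h => one_ne_zero (congrFun h 1))

/-- `γ : ℙ¹ → ℙ(E)` parametrizes a rational normal curve of degree `d` (in its linear span, which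
is a `ℙ ^ d`): `γ [x : y] = [∑ j, x ^ (d - j) y ^ j c_j]` with `c_0, …, c_d` linearly
independent. -/
def IsRationalNormalCurve (d : ℕ) (γ : P1 → ℙ ℂ E) : Prop :=
  ∃ c : Fin (d + 1) → E, LinearIndependent ℂ c ∧
    ∀ (v : Fin 2 → ℂ) (hv : v ≠ 0), (γ (Projectivization.mk ℂ v hv)).submodule =
      Submodule.span ℂ {∑ j : Fin (d + 1), (v 0 ^ (d - (j : ℕ)) * v 1 ^ (j : ℕ)) • c j}

end Projective

section Coordinates

variable {ι : Type*} [Fintype ι]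

/-- `T₀` is the flat limit at `t = 0`, that is the limit in the Grassmannian, of the algebraic
family of linear subspaces `T t`: there is a frame, polynomial in `t`, which is linearly independent
at `t = 0` and spans `T₀` there, and which spans `T t` for all but finitely many `t`. -/
def IsFlatLimit (T : ℂ → Submodule ℂ (ι → ℂ)) (T₀ : Submodule ℂ (ι → ℂ)) : Prop :=
  ∃ (k : ℕ) (f : Fin k → ι → Polynomial ℂ),
    LinearIndependent ℂ (fun j i => (f j i).eval 0) ∧
    Submodule.span ℂ (Set.range fun j i => (f j i).eval 0) = T₀ ∧
    ∀ᶠ t in Filter.cofinite, Submodule.span ℂ (Set.range fun j i => (f j i).eval t) = T t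

/-- `P p q` holds for general points `p, q` of the irreducible variety `X`: it holds on a nonempty
Zariski open subset of `X × X`, here the nonvanishing locus of a polynomial in the two sets of
homogeneous coordinates. -/
def ForGeneralPair (X : Set (ℙ ℂ (ι → ℂ))) (P : ℙ ℂ (ι → ℂ) → ℙ ℂ (ι → ℂ) → Prop) : Prop :=
  ∃ F : MvPolynomial (ι ⊕ ι) ℂ,
    (∃ x ∈ affineCone X, ∃ y ∈ affineCone X, MvPolynomial.eval (Sum.elim x y) F ≠ 0) ∧
    ∀ (x y : ι → ℂ) (hx : x ≠ 0) (hy : y ≠ 0),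
      Projectivization.mk ℂ x hx ∈ X → Projectivization.mk ℂ y hy ∈ X →
      MvPolynomial.eval (Sum.elim x y) F ≠ 0 →
      P (Projectivization.mk ℂ x hx) (Projectivization.mk ℂ y hy)

/-- The family `T_t = ⟨T_p^{s₁} X, T_{γ(t)}^{s₂} X⟩`. -/
def osculatingFamily (X : Set (ℙ ℂ (ι → ℂ))) (p : ℙ ℂ (ι → ℂ)) (γ : P1 → ℙ ℂ (ι → ℂ))
    (s₁ s₂ : ℕ) (t : ℂ) : Submodule ℂ (ι → ℂ) :=
  osculatingSpace X p s₁ ⊔ osculatingSpace X (γ (P1.ofAffine t)) s₂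

/-- For all `s₁, s₂ ≥ 0`, the family `T_t = ⟨T_p^{s₁} X, T_{γ(t)}^{s₂} X⟩` with `p = γ(0)` has a
flat limit at `t = 0`, and this limit is contained in `T_p^{s₁ + s₂ + 1} X`. -/
def HasOsculatingLimits (X : Set (ℙ ℂ (ι → ℂ))) (γ : P1 → ℙ ℂ (ι → ℂ)) : Prop :=
  ∀ s₁ s₂ : ℕ,
    (∃ T₀, IsFlatLimit (osculatingFamily X (γ (P1.ofAffine 0)) γ s₁ s₂) T₀) ∧
    ∀ T₀, IsFlatLimit (osculatingFamily X (γ (P1.ofAffine 0)) γ s₁ s₂) T₀ →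
      T₀ ≤ osculatingSpace X (γ (P1.ofAffine 0)) (s₁ + s₂ + 1)

/-- Strong `2`-osculating regularity of `X`, realized by rational normal curves of degree `d`: any
two general points `p, q` of `X` are joined by a rational normal curve `γ : ℙ¹ → X` of degree `d`
with `γ(0) = p`, `γ(∞) = q` for which the flat limits at `0` of the spaces
`⟨T_p^{s₁} X, T_{γ(t)}^{s₂} X⟩` lie in `T_p^{s₁ + s₂ + 1} X`. (Strong `2`-osculating regularity
itself allows an arbitrary smooth curve in place of `ℙ¹`, and a choice of the curve depending on
`s₁, s₂`; so the property here implies it.) -/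
def HasStrongTwoOsculatingRegularity (d : ℕ) (X : Set (ℙ ℂ (ι → ℂ))) : Prop :=
  ForGeneralPair X fun p q => ∃ γ : P1 → ℙ ℂ (ι → ℂ),
    IsRationalNormalCurve d γ ∧ (∀ x, γ x ∈ X) ∧ γ (P1.ofAffine 0) = p ∧ γ P1.infty = q ∧
    HasOsculatingLimits X γ

end Coordinates

/-! ### The Spinor variety -/

/-- The Pfaffian of a skew-symmetric matrix of size `2k`. -/
def pfaffian {k : ℕ} (A : Matrix (Fin (2 * k)) (Fin (2 * k)) ℂ) : ℂ :=
  ((2 : ℂ) ^ k * (k.factorial : ℂ))⁻¹ *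
    ∑ σ : Equiv.Perm (Fin (2 * k)), ((Equiv.Perm.sign σ : ℤ) : ℂ) *
      ∏ i : Fin k, A (σ ⟨2 * i, by omega⟩) (σ ⟨2 * i + 1, by omega⟩)

/-- The index set `Γ`: subsets of `{1, …, n}` of even cardinality. -/
abbrev EvenSubset (n : ℕ) : Type := {I : Finset (Fin n) // Even I.card}

/-- The half-spin space `Δ`, with its coordinates `P_I`, `I ∈ Γ`. -/
abbrev HalfSpin (n : ℕ) : Type := EvenSubset n → ℂ

/-- The principal Pfaffian `Pf(A_I)`. -/
def principalPfaffian {n : ℕ} (A : Matrix (Fin n) (Fin n) ℂ) (I : EvenSubset n) : ℂ :=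
  pfaffian (A.submatrix (I.1.orderEmbOfFin (Nat.two_mul_div_two_of_even I.2).symm)
    (I.1.orderEmbOfFin (Nat.two_mul_div_two_of_even I.2).symm))

/-- The affine chart `(I_n, A) ↦ (Pf(A_I))_{I ∈ Γ}` of the Spinor embedding, in homogeneous
coordinates. -/
def alpha {n : ℕ} (A : Matrix (Fin n) (Fin n) ℂ) : HalfSpin n :=
  fun I => principalPfaffian A I

theorem alpha_empty {n : ℕ} (A : Matrix (Fin n) (Fin n) ℂ) :
    alpha A ⟨∅, by simp⟩ = 1 := by
  have key : ∀ (k : ℕ) (B : Matrix (Fin (2 * k)) (Fin (2 * k)) ℂ), k = 0 → pfaffian B = 1 := by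
    rintro k B rfl
    simp [pfaffian]
  exact key _ _ (by simp)

theorem alpha_ne_zero {n : ℕ} (A : Matrix (Fin n) (Fin n) ℂ) : alpha A ≠ 0 := fun h => by
  have h1 := alpha_empty A
  rw [h] at h1
  exact zero_ne_one h1

/-- The Spinor variety `S_n ⊆ ℙ(Δ)` in the Spinor embedding: the Zariski closure of the image of
the skew-symmetric `n × n` matrices under the chart `alpha`. -/
def spinorVariety (n : ℕ) : Set (ℙ ℂ (HalfSpin n)) :=
  {p | ∀ (d : ℕ) (F : MvPolynomial (EvenSubset n) ℂ), F.IsHomogeneous d →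
    (∀ A : Matrix (Fin n) (Fin n) ℂ, A.transpose = -A → MvPolynomial.eval (alpha A) F = 0) →
    MvPolynomial.eval p.rep F = 0}

end SpinorVariety

end

/-! Identify `HalfSpin n` with the even part of the exterior algebra of ℂⁿ, and attach to A the
bivector ω_A = ½ ∑ A i j e_i ∧ e_j. The coefficient of ω_A^k at e_I, for |I| = 2k, is k! Pf(A_I), so
alpha A = exp(ω_A) applied to 1 (`alpha_eq_translation_vacuum`). The operators ω_A ∧ commute, raise
the degree |I|/2 by one and are nilpotent. Hence `translation B` = exp(ω_B ∧) carries the chart at 0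
to the chart at B, and the osculating space at [alpha B] is `translation B` applied to the span of
all products of at most s bivectors (`osculatingSpace_alpha`).

After translation the limit statement concerns vectors u + exp(r ω_A) v, with u and v in the spans
of order s₁ and s₂, and r → 0. If v has degree j, then l! times the degree l part of exp(ω_A) v is
l(l-1)⋯(l-j+1) ω_A^(l-j) v, whose coefficient is a polynomial in l of degree j. Its m-th finite
difference vanishes for m = s₂ + 1 > j. This gives linear relations among the components of degrees
k, …, k + m, which u does not disturb when k > s₁. With r ω_A in place of ω_A, every term but that
of degree k + m carries a positive power of r, so in the limit all components of degree at least s₁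
+ s₂ + 2 vanish (`mem_wedgeSpan_of_eventually`). Flat limits exist by Smith normal form over ℂ[t]
(`exists_isFlatLimit`).

The curves are t ↦ alpha (B + t/(1 + ct) A). With m = ⌊n/2⌋, their coefficients are independent as
soon as ω_A^m ≠ 0, which contraction arguments derive from the rank of A (`bivector_pow_ne_zero`).
Taking c = 1 and A = C - B joins [alpha B] to [alpha C] and gives (1); taking c = 0 and B = 0 gives
(2). -/

noncomputable section

namespace SpinorVariety

/-! ### The exterior algebra model of the half-spin space -/

section Exterior

variable {n : ℕ}

/-- The basis of the exterior algebra of `ℂ ^ n` given by the ordered products of the standard basis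
vectors. -/
def extBasis (n : ℕ) : Module.Basis (Finset (Fin n)) ℂ (ExteriorAlgebra ℂ (Fin n → ℂ)) :=
  (Pi.basisFun ℂ (Fin n)).ExteriorAlgebra

theorem extBasis_mem (I : Finset (Fin n)) : extBasis n I ∈ ⋀[ℂ]^I.card (Fin n → ℂ) := by
  rw [extBasis, ExteriorAlgebra.basis_apply_ofCard _ rfl]
  exact ExteriorAlgebra.ιMulti_range ℂ _ ⟨_, rfl⟩

/-- The basis of the exterior algebra restricts in each degree to the basis of the exterior power,
whose dual basis is given by minors. -/
theorem extBasis_repr_coe {k : ℕ} (x : ⋀[ℂ]^k (Fin n → ℂ)) (I : Finset (Fin n)) :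
    (extBasis n).repr (x : ExteriorAlgebra ℂ (Fin n → ℂ)) I =
      if h : I.card = k then
        exteriorPower.ιMultiDual ℂ k (Pi.basisFun ℂ (Fin n)) (Set.powersetCard.ofCard h) x
      else 0 := by
  set b := (Pi.basisFun ℂ (Fin n))
  have key : ∀ x : ⋀[ℂ]^k (Fin n → ℂ), (extBasis n).repr (x : ExteriorAlgebra ℂ (Fin n → ℂ)) =
      ∑ s : Set.powersetCard (Fin n) k, ((b.exteriorPower k).repr x s) •
        Finsupp.single (s : Finset (Fin n)) (1 : ℂ) := by
    intro x
    conv_lhs => rw [← (b.exteriorPower k).sum_repr x]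
    rw [Submodule.coe_sum, map_sum]
    refine Finset.sum_congr rfl fun s _ => ?_
    rw [Submodule.coe_smul, map_smul, ← ExteriorAlgebra.basis_eq_coe_basis b s]
    congr 1
    exact (extBasis n).repr_self _
  rw [key, Finsupp.finsetSum_apply]
  split_ifs with h
  · rw [← exteriorPower.basis_repr_apply]
    rw [Finset.sum_eq_single (Set.powersetCard.ofCard h)]
    · simp
    · intro s _ hs
      have : (s : Finset (Fin n)) ≠ I := fun h' => hs (Subtype.ext h')
      simp [this]
    · simp
  · refine Finset.sum_eq_zero fun s _ => ?_
    have : (s : Finset (Fin n)) ≠ I := fun h' => h (h' ▸ s.2)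
    simp [this]

theorem extBasis_repr_of_mem {k : ℕ} {x : ExteriorAlgebra ℂ (Fin n → ℂ)}
    (hx : x ∈ ⋀[ℂ]^k (Fin n → ℂ)) {I : Finset (Fin n)} (hI : I.card ≠ k) :
    (extBasis n).repr x I = 0 := by
  have := extBasis_repr_coe ⟨x, hx⟩ I
  rwa [dif_neg hI] at this

theorem extBasis_repr_ιMulti {k : ℕ} (v : Fin k → Fin n → ℂ) {I : Finset (Fin n)}
    (hI : I.card = k) :
    (extBasis n).repr (ExteriorAlgebra.ιMulti ℂ k v) I =
      (Matrix.of fun i j => v i (I.orderEmbOfFin hI j)).det := by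
  have := extBasis_repr_coe (exteriorPower.ιMulti ℂ k v) I
  rw [dif_pos hI, exteriorPower.ιMultiDual_apply_ιMulti] at this
  rw [exteriorPower.ιMulti_apply_coe] at this
  rw [this]
  rfl

/-- The bivector `½ ∑ A i j • e i ∧ e j` of a matrix. -/
def bivector : Matrix (Fin n) (Fin n) ℂ →ₗ[ℂ] ExteriorAlgebra ℂ (Fin n → ℂ) where
  toFun A := (2 : ℂ)⁻¹ • ∑ p : Fin n × Fin n, A p.1 p.2 •
    (ExteriorAlgebra.ι ℂ (Pi.single p.1 (1 : ℂ)) * ExteriorAlgebra.ι ℂ (Pi.single p.2 (1 : ℂ)))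
  map_add' A B := by
    simp only [Matrix.add_apply, add_smul, Finset.sum_add_distrib, smul_add]
  map_smul' c A := by
    simp only [Matrix.smul_apply, smul_assoc, ← Finset.smul_sum, RingHom.id_apply]
    rw [smul_comm]

theorem bivector_apply (A : Matrix (Fin n) (Fin n) ℂ) :
    bivector A = (2 : ℂ)⁻¹ • ∑ p : Fin n × Fin n, A p.1 p.2 •
      (ExteriorAlgebra.ι ℂ (Pi.single p.1 (1 : ℂ)) *
        ExteriorAlgebra.ι ℂ (Pi.single p.2 (1 : ℂ))) := rfl

theorem bivector_mem (A : Matrix (Fin n) (Fin n) ℂ) : bivector A ∈ ⋀[ℂ]^2 (Fin n → ℂ) := by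
  rw [bivector_apply]
  refine Submodule.smul_mem _ _ (Submodule.sum_mem _ fun p _ => Submodule.smul_mem _ _ ?_)
  rw [ExteriorAlgebra.exteriorPower, pow_two]
  exact Submodule.mul_mem_mul ⟨_, rfl⟩ ⟨_, rfl⟩

theorem bivector_mul_mem (A : Matrix (Fin n) (Fin n) ℂ) {k : ℕ}
    {x : ExteriorAlgebra ℂ (Fin n → ℂ)} (hx : x ∈ ⋀[ℂ]^k (Fin n → ℂ)) :
    bivector A * x ∈ ⋀[ℂ]^(k + 2) (Fin n → ℂ) := by
  rw [add_comm, ExteriorAlgebra.exteriorPower, pow_add]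
  exact Submodule.mul_mem_mul (bivector_mem A) hx

theorem bivector_pow_mem (A : Matrix (Fin n) (Fin n) ℂ) (k : ℕ) :
    bivector A ^ k ∈ ⋀[ℂ]^(2 * k) (Fin n → ℂ) := by
  rw [ExteriorAlgebra.exteriorPower, pow_mul]
  exact Submodule.pow_mem_pow _ (bivector_mem A) k

theorem commute_ι_mul_ι_ι (x y z : Fin n → ℂ) :
    Commute (ExteriorAlgebra.ι ℂ x * ExteriorAlgebra.ι ℂ y) (ExteriorAlgebra.ι ℂ z) := by
  have h1 := eq_neg_of_add_eq_zero_left (ExteriorAlgebra.ι_add_mul_swap (R := ℂ) y z)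
  have h2 := eq_neg_of_add_eq_zero_left (ExteriorAlgebra.ι_add_mul_swap (R := ℂ) x z)
  rw [Commute, SemiconjBy, mul_assoc, h1, mul_neg, ← mul_assoc, h2]
  simp [mul_assoc]

theorem commute_bivector_ι (A : Matrix (Fin n) (Fin n) ℂ) (z : Fin n → ℂ) :
    Commute (bivector A) (ExteriorAlgebra.ι ℂ z) := by
  rw [bivector_apply]
  exact (Commute.sum_left _ _ _ fun p _ => (commute_ι_mul_ι_ι _ _ _).smul_left _).smul_left _

theorem commute_bivector (A B : Matrix (Fin n) (Fin n) ℂ) :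
    Commute (bivector A) (bivector B) := by
  rw [bivector_apply B]
  exact (Commute.sum_right _ _ _ fun p _ =>
    ((commute_bivector_ι A _).mul_right (commute_bivector_ι A _)).smul_right _).smul_right _

/-- The ordered product over consecutive pairs. -/
theorem prod_pairs_eq_ιMulti {k : ℕ} (x y : Fin k → Fin n → ℂ) (v : Fin (2 * k) → Fin n → ℂ)
    (hx : ∀ i : Fin k, v ⟨2 * i, by omega⟩ = x i)
    (hy : ∀ i : Fin k, v ⟨2 * i + 1, by omega⟩ = y i) :
    (List.ofFn fun i => ExteriorAlgebra.ι ℂ (x i) * ExteriorAlgebra.ι ℂ (y i)).prod =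
      ExteriorAlgebra.ιMulti ℂ (2 * k) v := by
  induction k with
  | zero => simp
  | succ k ih =>
    rw [List.ofFn_succ, List.prod_cons]
    have e : ExteriorAlgebra.ιMulti ℂ (2 * (k + 1)) v =
        ExteriorAlgebra.ι ℂ (v ⟨0, by omega⟩) * (ExteriorAlgebra.ι ℂ (v ⟨1, by omega⟩) *
          ExteriorAlgebra.ιMulti ℂ (2 * k) fun i => v ⟨i + 2, by omega⟩) := by
      change ExteriorAlgebra.ιMulti ℂ (2 * k + 1 + 1) v = _
      rw [ExteriorAlgebra.ιMulti_succ_apply, ExteriorAlgebra.ιMulti_succ_apply]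
      rfl
    rw [e, ← mul_assoc, ih (fun i => x i.succ) (fun i => y i.succ) (fun i => v ⟨i + 2, by omega⟩)
      (fun i => ?_) (fun i => ?_), ← hx 0, ← hy 0]
    · rfl
    · rw [← hx]; congr 1
    · rw [← hy]; congr 1

/-- The ring is not assumed commutative, so the power is expanded into ordered words instead of
multinomial terms. -/
theorem pow_sum_eq_sum_ofFn {κ R : Type*} [Fintype κ] [Ring R] (f : κ → R) (k : ℕ) :
    (∑ p, f p) ^ k = ∑ q : Fin k → κ, (List.ofFn fun i => f (q i)).prod := by
  induction k with
  | zero => simp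
  | succ k ih =>
    rw [pow_succ', ih, Finset.sum_mul_sum, ← Finset.sum_product', Finset.univ_product_univ]
    refine (Fin.consEquiv fun _ : Fin (k + 1) => κ).sum_comp _ |>.symm.trans ?_ |>.symm
    refine Finset.sum_congr rfl fun q _ => ?_
    simp [List.ofFn_succ, Fin.consEquiv]

theorem list_prod_ofFn_smul {R : Type*} [Ring R] [Algebra ℂ R] {k : ℕ} (c : Fin k → ℂ)
    (f : Fin k → R) :
    (List.ofFn fun i => c i • f i).prod = (∏ i, c i) • (List.ofFn f).prod := by
  induction k with
  | zero => simp
  | succ k ih =>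
    rw [List.ofFn_succ, List.prod_cons, ih, Fin.prod_univ_succ, List.ofFn_succ, List.prod_cons,
      smul_mul_smul_comm]

end Exterior

/-! ### Pfaffians as coefficients of powers of a bivector -/

section PfaffianCoordinates

variable {n : ℕ}

/-- The sequence of the entries of a sequence of pairs. -/
def interleave {k : ℕ} {κ : Type*} (q : Fin k → κ × κ) (a : Fin (2 * k)) : κ :=
  if (a : ℕ) % 2 = 0 then (q ⟨a / 2, by omega⟩).1 else (q ⟨a / 2, by omega⟩).2

theorem interleave_even {k : ℕ} {κ : Type*} (q : Fin k → κ × κ) (i : Fin k) :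
    interleave q ⟨2 * i, by omega⟩ = (q i).1 := by
  simp [interleave]

theorem interleave_odd {k : ℕ} {κ : Type*} (q : Fin k → κ × κ) (i : Fin k) :
    interleave q ⟨2 * i + 1, by omega⟩ = (q i).2 := by
  have : (⟨(2 * (i : ℕ) + 1) / 2, by omega⟩ : Fin k) = i := Fin.ext (by simp; omega)
  simp [interleave, this, Nat.add_mod]

theorem interleave_eq_iff {k : ℕ} {κ : Type*} (q : Fin k → κ × κ) (f : Fin (2 * k) → κ) :
    (∀ a, interleave q a = f a) ↔
      q = fun i : Fin k => (f ⟨2 * i, by omega⟩, f ⟨2 * i + 1, by omega⟩) := by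
  constructor
  · intro h
    funext i
    rw [← h, ← h, interleave_even, interleave_odd]
  · rintro rfl a
    unfold interleave
    split_ifs with h
    · exact congrArg f (Fin.ext (by simp; omega))
    · exact congrArg f (Fin.ext (by simp; omega))

theorem bivector_pow (A : Matrix (Fin n) (Fin n) ℂ) (k : ℕ) :
    bivector A ^ k = ((2 : ℂ) ^ k)⁻¹ • ∑ q : Fin k → Fin n × Fin n,
      (∏ i, A (q i).1 (q i).2) •
        ExteriorAlgebra.ιMulti ℂ (2 * k) fun a => Pi.single (interleave q a) (1 : ℂ) := by
  rw [bivector_apply, smul_pow, pow_sum_eq_sum_ofFn, inv_pow]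
  congr 1
  refine Finset.sum_congr rfl fun q _ => ?_
  rw [list_prod_ofFn_smul]
  congr 1
  refine prod_pairs_eq_ιMulti _ _ _ (fun i => ?_) (fun i => ?_)
  · rw [interleave_even]
  · rw [interleave_odd]

/-- Each σ contributes for exactly one sequence of pairs q. Exchanging the sums over q and σ
therefore turns the expansion of a power of the bivector into the sum defining the Pfaffian. -/
theorem det_single_interleave {k : ℕ} (q : Fin k → Fin n × Fin n) (g : Fin (2 * k) → Fin n) :
    (Matrix.of fun a b => (Pi.single (interleave q a) (1 : ℂ) : Fin n → ℂ) (g b)).det =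
      ∑ σ : Equiv.Perm (Fin (2 * k)), ((Equiv.Perm.sign σ : ℤ) : ℂ) *
        if q = fun i : Fin k => (g (σ ⟨2 * i, by omega⟩), g (σ ⟨2 * i + 1, by omega⟩))
        then 1 else 0 := by
  rw [← Matrix.det_transpose, Matrix.det_apply']
  refine Finset.sum_congr rfl fun σ _ => ?_
  congr 1
  simp only [Matrix.transpose_apply, Matrix.of_apply, Pi.single_apply]
  split_ifs with h
  · rw [← interleave_eq_iff q (fun a => g (σ a))] at h
    simp [h]
  · rw [← interleave_eq_iff q (fun a => g (σ a))] at h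
    push Not at h
    obtain ⟨a, ha⟩ := h
    exact Finset.prod_eq_zero (Finset.mem_univ a) (if_neg ha.symm)

/-- The factor ½ in the bivector accounts for the 2^k in the normalisation of the Pfaffian; the k!
remains. -/
theorem extBasis_repr_bivector_pow (A : Matrix (Fin n) (Fin n) ℂ) (k : ℕ) {I : Finset (Fin n)}
    (hI : I.card = 2 * k) :
    (extBasis n).repr (bivector A ^ k) I =
      k.factorial * pfaffian (A.submatrix (I.orderEmbOfFin hI) (I.orderEmbOfFin hI)) := by
  rw [bivector_pow, map_smul, Finsupp.smul_apply, map_sum, Finsupp.finsetSum_apply]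
  simp only [map_smul, Finsupp.smul_apply, extBasis_repr_ιMulti _ hI, det_single_interleave,
    smul_eq_mul, Finset.mul_sum]
  rw [Finset.sum_comm, pfaffian, Finset.mul_sum, Finset.mul_sum]
  refine Finset.sum_congr rfl fun σ _ => ?_
  rw [Finset.sum_eq_single (fun i : Fin k => ((I.orderEmbOfFin hI) (σ ⟨2 * i, by omega⟩),
    (I.orderEmbOfFin hI) (σ ⟨2 * i + 1, by omega⟩)))]
  · have : (k.factorial : ℂ) ≠ 0 := by exact_mod_cast k.factorial_ne_zero
    simp only [if_true, Matrix.submatrix_apply]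
    field_simp
  · intro q _ hq
    simp [hq]
  · simp

theorem extBasis_repr_bivector_pow_half (A : Matrix (Fin n) (Fin n) ℂ) (I : EvenSubset n) :
    (extBasis n).repr (bivector A ^ (I.1.card / 2)) I.1 =
      (I.1.card / 2).factorial * alpha A I :=
  extBasis_repr_bivector_pow A _ _

end PfaffianCoordinates

/-! ### Wedge operators, the grading and the unipotent translations -/

section Operators

variable {n : ℕ}

/-- The coordinates of the even part of an element of the exterior algebra. -/
def toHalf (n : ℕ) : ExteriorAlgebra ℂ (Fin n → ℂ) →ₗ[ℂ] HalfSpin n where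
  toFun x I := (extBasis n).repr x I.1
  map_add' x y := by ext I; simp
  map_smul' c x := by ext I; simp

/-- The even element of the exterior algebra with given coordinates. -/
def ofHalf (n : ℕ) : HalfSpin n →ₗ[ℂ] ExteriorAlgebra ℂ (Fin n → ℂ) where
  toFun x := ∑ I, x I • extBasis n I.1
  map_add' x y := by simp [add_smul, Finset.sum_add_distrib]
  map_smul' c x := by simp [mul_smul, Finset.smul_sum]

@[simp]
theorem toHalf_apply (x : ExteriorAlgebra ℂ (Fin n → ℂ)) (I : EvenSubset n) :
    toHalf n x I = (extBasis n).repr x I.1 := rfl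

theorem ofHalf_apply (x : HalfSpin n) : ofHalf n x = ∑ I, x I • extBasis n I.1 := rfl

theorem toHalf_ofHalf (x : HalfSpin n) : toHalf n (ofHalf n x) = x := by
  ext I
  rw [toHalf_apply, ofHalf_apply, map_sum, Finsupp.finsetSum_apply, Finset.sum_eq_single I]
  · simp
  · intro J _ hJ
    have : J.1 ≠ I.1 := fun h => hJ (Subtype.ext h)
    simp [this]
  · simp

/-- Multiplication by the bivector of a matrix, as an operator on the half-spin space. -/
def wedge : Matrix (Fin n) (Fin n) ℂ →ₗ[ℂ] Module.End ℂ (HalfSpin n) where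
  toFun A := toHalf n ∘ₗ LinearMap.mulLeft ℂ (bivector A) ∘ₗ ofHalf n
  map_add' A B := by ext; simp [add_mul]
  map_smul' c A := by ext; simp

/-- Multiplication by a bivector preserves parity, so it commutes with passing to the even part.
Identities for `wedge` can thus be checked in the exterior algebra. -/
theorem wedge_toHalf (A : Matrix (Fin n) (Fin n) ℂ) (x : ExteriorAlgebra ℂ (Fin n → ℂ)) :
    wedge A (toHalf n x) = toHalf n (bivector A * x) := by
  change toHalf n (bivector A * ofHalf n (toHalf n x)) = _
  suffices h : toHalf n ∘ₗ LinearMap.mulLeft ℂ (bivector A) ∘ₗ ofHalf n ∘ₗ toHalf n =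
      toHalf n ∘ₗ LinearMap.mulLeft ℂ (bivector A) from LinearMap.congr_fun h x
  refine (extBasis n).ext fun J => ?_
  simp only [LinearMap.comp_apply, LinearMap.mulLeft_apply]
  by_cases hJ : Even J.card
  · congr 2
    rw [ofHalf_apply, Finset.sum_eq_single ⟨J, hJ⟩]
    · simp
    · intro I _ hI
      have : J ≠ I.1 := fun h => hI (Subtype.ext h.symm)
      simp [this]
    · simp
  · have h1 : toHalf n (extBasis n J) = 0 := by
      ext I
      have : J ≠ I.1 := fun h => hJ (h ▸ I.2)
      simp [this]
    rw [h1, map_zero, mul_zero, map_zero]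
    ext I
    rw [toHalf_apply, extBasis_repr_of_mem (bivector_mul_mem A (extBasis_mem J))]
    · rfl
    · intro h
      have := I.2
      rw [h] at this
      exact hJ (by simpa [Nat.even_add] using this)

theorem toHalf_surjective : Function.Surjective (toHalf n) := fun x => ⟨_, toHalf_ofHalf x⟩

theorem commute_wedge (A B : Matrix (Fin n) (Fin n) ℂ) : Commute (wedge A) (wedge B) := by
  refine LinearMap.ext fun x => ?_
  obtain ⟨x, rfl⟩ := toHalf_surjective x
  simp only [Module.End.mul_apply, wedge_toHalf, ← mul_assoc, (commute_bivector A B).eq]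

theorem wedge_pow_toHalf (A : Matrix (Fin n) (Fin n) ℂ) (k : ℕ)
    (x : ExteriorAlgebra ℂ (Fin n → ℂ)) :
    (wedge A ^ k) (toHalf n x) = toHalf n (bivector A ^ k * x) := by
  induction k with
  | zero => simp
  | succ k ih => rw [pow_succ', Module.End.mul_apply, ih, wedge_toHalf, ← mul_assoc, ← pow_succ']

/-- The degree `k` part of a vector of the half-spin space, `P_I` having degree `|I| / 2`. -/
def degProj (n k : ℕ) : Module.End ℂ (HalfSpin n) where
  toFun x I := if I.1.card = 2 * k then x I else 0
  map_add' x y := by ext I; by_cases h : I.1.card = 2 * k <;> simp [h]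
  map_smul' c x := by ext I; by_cases h : I.1.card = 2 * k <;> simp [h]

theorem degProj_apply (k : ℕ) (x : HalfSpin n) (I : EvenSubset n) :
    degProj n k x I = if I.1.card = 2 * k then x I else 0 := rfl

theorem degProj_degProj (k l : ℕ) (x : HalfSpin n) :
    degProj n k (degProj n l x) = if k = l then degProj n k x else 0 := by
  ext I
  by_cases h : k = l
  · subst h; simp only [degProj_apply, if_true]; split_ifs <;> rfl
  · simp only [degProj_apply, h, if_false]
    split_ifs
    · omega
    · rfl
    · rfl

theorem sum_degProj (x : HalfSpin n) {N : ℕ} (hN : n < 2 * N) :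
    ∑ k ∈ Finset.range N, degProj n k x = x := by
  ext I
  rw [Finset.sum_apply]
  have hc : I.1.card ≤ n := by simpa using Finset.card_le_univ I.1
  have he := Nat.two_mul_div_two_of_even I.2
  rw [Finset.sum_eq_single (I.1.card / 2)]
  · rw [degProj_apply, if_pos he.symm]
  · intro k _ hk
    rw [degProj_apply, if_neg (by omega)]
  · intro h
    simp at h
    omega

theorem degProj_wedge_of_degProj_eq (A : Matrix (Fin n) (Fin n) ℂ) {k : ℕ} {x : HalfSpin n}
    (hx : degProj n k x = x) : degProj n (k + 1) (wedge A x) = wedge A x := by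
  have hmem : ofHalf n x ∈ ⋀[ℂ]^(2 * k) (Fin n → ℂ) := by
    rw [ofHalf_apply]
    refine Submodule.sum_mem _ fun I _ => ?_
    by_cases h : I.1.card = 2 * k
    · exact Submodule.smul_mem _ _ (h ▸ extBasis_mem I.1)
    · rw [← hx, degProj_apply, if_neg h, zero_smul]
      exact zero_mem _
  ext I
  rw [degProj_apply]
  split_ifs with h
  · rfl
  · rw [← toHalf_ofHalf x, wedge_toHalf, toHalf_apply,
      extBasis_repr_of_mem (bivector_mul_mem A hmem) (by omega)]

theorem degProj_succ_wedge (A : Matrix (Fin n) (Fin n) ℂ) (k : ℕ) (x : HalfSpin n) :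
    degProj n (k + 1) (wedge A x) = wedge A (degProj n k x) := by
  conv_lhs => rw [← sum_degProj x (N := n + k + 1) (by omega)]
  rw [map_sum, map_sum, Finset.sum_eq_single k]
  · exact degProj_wedge_of_degProj_eq A (by rw [degProj_degProj, if_pos rfl])
  · intro l _ hl
    rw [← degProj_wedge_of_degProj_eq A (k := l) (x := degProj n l x)
      (by rw [degProj_degProj, if_pos rfl]), degProj_degProj, if_neg (by omega)]
  · intro h
    simp at h

theorem degProj_zero_wedge (A : Matrix (Fin n) (Fin n) ℂ) (x : HalfSpin n) :
    degProj n 0 (wedge A x) = 0 := by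
  conv_lhs => rw [← sum_degProj x (N := n + 1) (by omega)]
  rw [map_sum, map_sum]
  refine Finset.sum_eq_zero fun l _ => ?_
  rw [← degProj_wedge_of_degProj_eq A (k := l) (x := degProj n l x)
      (by rw [degProj_degProj, if_pos rfl]), degProj_degProj, if_neg (by omega)]

theorem degProj_wedge_pow (A : Matrix (Fin n) (Fin n) ℂ) (i l : ℕ) (x : HalfSpin n) :
    degProj n l ((wedge A ^ i) x) = if i ≤ l then (wedge A ^ i) (degProj n (l - i) x) else 0 := by
  induction i generalizing l with
  | zero => simp
  | succ i ih =>
    rw [pow_succ', Module.End.mul_apply, Module.End.mul_apply]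
    rcases l with _ | l
    · rw [degProj_zero_wedge, if_neg (by omega)]
    · rw [degProj_succ_wedge, ih]
      by_cases h : i ≤ l
      · rw [if_pos h, if_pos (by omega), Nat.succ_sub_succ]
      · rw [if_neg h, if_neg (by omega), map_zero]

/-- Each factor raises the degree by one, and degrees do not exceed n/2. -/
theorem wedge_pow_eq_zero (A : Matrix (Fin n) (Fin n) ℂ) {N : ℕ} (hN : n < 2 * N) :
    wedge A ^ N = 0 := by
  refine LinearMap.ext fun x => ?_
  rw [← sum_degProj ((wedge A ^ N) x) hN, LinearMap.zero_apply]
  refine Finset.sum_eq_zero fun l hl => ?_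
  rw [degProj_wedge_pow, if_neg]
  simpa using hl

theorem isNilpotent_wedge (A : Matrix (Fin n) (Fin n) ℂ) : IsNilpotent (wedge A) :=
  ⟨n + 1, wedge_pow_eq_zero A (by omega)⟩

/-- The unipotent transformation `exp (wedge A)` of the half-spin space. -/
def translation (A : Matrix (Fin n) (Fin n) ℂ) : Module.End ℂ (HalfSpin n) :=
  IsNilpotent.exp (wedge A)

theorem translation_eq_sum (A : Matrix (Fin n) (Fin n) ℂ) (x : HalfSpin n) {N : ℕ}
    (hN : n < 2 * N) :
    translation A x = ∑ k ∈ Finset.range N, (k.factorial : ℂ)⁻¹ • (wedge A ^ k) x := by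
  rw [translation, IsNilpotent.exp_eq_sum (wedge_pow_eq_zero A hN), LinearMap.sum_apply]
  refine Finset.sum_congr rfl fun k _ => ?_
  rw [LinearMap.smul_apply, ← Rat.cast_smul_eq_qsmul ℂ]
  simp

theorem translation_apply (A : Matrix (Fin n) (Fin n) ℂ) (x : HalfSpin n) :
    translation A x = ∑ k ∈ Finset.range (n + 1), (k.factorial : ℂ)⁻¹ • (wedge A ^ k) x :=
  translation_eq_sum A x (by omega)

theorem commute_wedge_translation (A B : Matrix (Fin n) (Fin n) ℂ) :
    Commute (wedge A) (translation B) := by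
  refine LinearMap.ext fun x => ?_
  simp only [Module.End.mul_apply, translation_apply, map_sum, map_smul]
  refine Finset.sum_congr rfl fun k _ => ?_
  rw [← Module.End.mul_apply, ((commute_wedge A B).pow_right k).eq, Module.End.mul_apply]

theorem translation_add (A B : Matrix (Fin n) (Fin n) ℂ) :
    translation (A + B) = translation A * translation B := by
  rw [translation, map_add, IsNilpotent.exp_add_of_commute (commute_wedge A B)
    (isNilpotent_wedge A) (isNilpotent_wedge B)]
  rfl

@[simp]
theorem translation_zero : translation (0 : Matrix (Fin n) (Fin n) ℂ) = 1 := by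
  rw [translation, map_zero, IsNilpotent.exp_zero]

theorem translation_neg_apply (A : Matrix (Fin n) (Fin n) ℂ) (x : HalfSpin n) :
    translation (-A) (translation A x) = x := by
  rw [← Module.End.mul_apply, ← translation_add, neg_add_cancel, translation_zero,
    Module.End.one_apply]

theorem translation_injective (A : Matrix (Fin n) (Fin n) ℂ) :
    Function.Injective (translation A) :=
  Function.LeftInverse.injective (translation_neg_apply A)

/-- The vector `e_∅` of the half-spin space. -/
def vacuum (n : ℕ) : HalfSpin n := toHalf n 1

theorem degProj_zero_vacuum : degProj n 0 (vacuum n) = vacuum n := by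
  ext I
  rw [degProj_apply]
  split_ifs with h
  · rfl
  · have h1 : (1 : ExteriorAlgebra ℂ (Fin n → ℂ)) ∈ ⋀[ℂ]^0 (Fin n → ℂ) := by
      rw [ExteriorAlgebra.exteriorPower, pow_zero]
      exact Submodule.one_le.mp le_rfl
    rw [vacuum, toHalf_apply, extBasis_repr_of_mem h1 (by simpa using h)]

/-- The 1/k! of the exponential cancels the k! in front of the Pfaffian, and only k = |I|/2 reaches
the coordinate I. -/
theorem alpha_eq_translation_vacuum (A : Matrix (Fin n) (Fin n) ℂ) :
    alpha A = translation A (vacuum n) := by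
  rw [translation_apply]
  ext I
  have hc : I.1.card ≤ n := by simpa using Finset.card_le_univ I.1
  have he := Nat.two_mul_div_two_of_even I.2
  rw [Finset.sum_apply, Finset.sum_eq_single (I.1.card / 2)]
  · rw [vacuum, wedge_pow_toHalf, mul_one, Pi.smul_apply, toHalf_apply,
      extBasis_repr_bivector_pow_half, smul_eq_mul, inv_mul_cancel_left₀]
    exact_mod_cast Nat.factorial_ne_zero _
  · intro k _ hk
    rw [vacuum, wedge_pow_toHalf, mul_one, Pi.smul_apply, toHalf_apply,
      extBasis_repr_of_mem (bivector_pow_mem A k) (by omega), smul_zero]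
  · intro h
    simp at h
    omega

theorem alpha_add (A B : Matrix (Fin n) (Fin n) ℂ) : alpha (A + B) = translation A (alpha B) := by
  rw [alpha_eq_translation_vacuum, alpha_eq_translation_vacuum, translation_add,
    Module.End.mul_apply]

theorem degProj_alpha (A : Matrix (Fin n) (Fin n) ℂ) (k : ℕ) (hk : k ≤ n) :
    degProj n k (alpha A) = (k.factorial : ℂ)⁻¹ • (wedge A ^ k) (vacuum n) := by
  rw [alpha_eq_translation_vacuum, translation_apply, map_sum, Finset.sum_eq_single k]
  · rw [map_smul, degProj_wedge_pow, if_pos le_rfl, Nat.sub_self, degProj_zero_vacuum]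
  · intro i _ hi
    rw [map_smul, degProj_wedge_pow]
    split_ifs with h
    · rw [← degProj_zero_vacuum, degProj_degProj, if_neg (by omega), map_zero, smul_zero]
    · rw [smul_zero]
  · intro h
    simp at h
    omega

end Operators

/-! ### Spans of products of bivectors and their limits -/

section Osculation

variable {n : ℕ}

/-- The span of the products of at most `s` wedge operators of skew-symmetric matrices applied to
the vacuum vector. -/
def wedgeSpan (n s : ℕ) : Submodule ℂ (HalfSpin n) :=
  Submodule.span ℂ {w | ∃ k ≤ s, ∃ V : Fin k → Matrix (Fin n) (Fin n) ℂ,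
    (∀ i, (V i).transpose = -V i) ∧ w = (List.ofFn fun i => wedge (V i)).prod (vacuum n)}

theorem wedgeSpan_mono {s s' : ℕ} (h : s ≤ s') : wedgeSpan n s ≤ wedgeSpan n s' :=
  Submodule.span_mono fun _ ⟨k, hk, V, hV⟩ => ⟨k, hk.trans h, V, hV⟩

theorem degProj_prod_wedge_vacuum (k : ℕ) (V : Fin k → Matrix (Fin n) (Fin n) ℂ) :
    degProj n k ((List.ofFn fun i => wedge (V i)).prod (vacuum n)) =
      (List.ofFn fun i => wedge (V i)).prod (vacuum n) := by
  induction k with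
  | zero => simpa using degProj_zero_vacuum
  | succ k ih =>
    rw [List.ofFn_succ, List.prod_cons, Module.End.mul_apply]
    exact degProj_wedge_of_degProj_eq _ (ih fun i => V i.succ)

theorem degProj_mem_wedgeSpan {s : ℕ} {x : HalfSpin n} (hx : x ∈ wedgeSpan n s) (l : ℕ) :
    degProj n l x ∈ wedgeSpan n l := by
  induction hx using Submodule.span_induction with
  | mem w hw =>
    obtain ⟨k, hk, V, hV, rfl⟩ := hw
    rw [← degProj_prod_wedge_vacuum, degProj_degProj]
    split_ifs with h
    · subst h
      rw [degProj_prod_wedge_vacuum]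
      exact Submodule.subset_span ⟨l, le_rfl, V, hV, rfl⟩
    · exact zero_mem _
  | zero => rw [map_zero]; exact zero_mem _
  | add x y _ _ hx hy => rw [map_add]; exact add_mem hx hy
  | smul c x _ hx => rw [map_smul]; exact Submodule.smul_mem _ _ hx

theorem degProj_eq_zero_of_mem_wedgeSpan {s : ℕ} {x : HalfSpin n} (hx : x ∈ wedgeSpan n s) {l : ℕ}
    (hl : s < l) : degProj n l x = 0 := by
  induction hx using Submodule.span_induction with
  | mem w hw =>
    obtain ⟨k, hk, V, hV, rfl⟩ := hw
    rw [← degProj_prod_wedge_vacuum, degProj_degProj, if_neg (by omega)]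
  | zero => rw [map_zero]
  | add x y _ _ hx hy => rw [map_add, hx, hy, add_zero]
  | smul c x _ hx => rw [map_smul, hx, smul_zero]

/-- `wedgeSpan` has homogeneous generators, hence is graded: its order can be lowered once the
high-degree components are known to vanish. This reduces containment of the limit to a vanishing
statement. -/
theorem mem_wedgeSpan_of_degProj_eq_zero {s s' : ℕ} {x : HalfSpin n} (hx : x ∈ wedgeSpan n s)
    (h : ∀ l, s' < l → degProj n l x = 0) : x ∈ wedgeSpan n s' := by
  rw [← sum_degProj x (N := n + 1) (by omega)]
  refine Submodule.sum_mem _ fun l _ => ?_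
  by_cases hl : s' < l
  · rw [h l hl]; exact zero_mem _
  · exact wedgeSpan_mono (by omega) (degProj_mem_wedgeSpan hx l)

theorem wedge_mem_wedgeSpan {A : Matrix (Fin n) (Fin n) ℂ} (hA : A.transpose = -A) {s : ℕ}
    {x : HalfSpin n} (hx : x ∈ wedgeSpan n s) : wedge A x ∈ wedgeSpan n (s + 1) := by
  induction hx using Submodule.span_induction with
  | mem w hw =>
    obtain ⟨k, hk, V, hV, rfl⟩ := hw
    refine Submodule.subset_span ⟨k + 1, by omega, Fin.cons A V, ?_, ?_⟩
    · intro i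
      refine Fin.cases ?_ (fun i => ?_) i
      · simpa using hA
      · simpa using hV i
    · simp [List.ofFn_succ]
  | zero => rw [map_zero]; exact zero_mem _
  | add x y _ _ hx hy => rw [map_add]; exact add_mem hx hy
  | smul c x _ hx => rw [map_smul]; exact Submodule.smul_mem _ _ hx

theorem translation_mem_wedgeSpan {A : Matrix (Fin n) (Fin n) ℂ} (hA : A.transpose = -A) {s : ℕ}
    {x : HalfSpin n} (hx : x ∈ wedgeSpan n s) : translation A x ∈ wedgeSpan n (s + n) := by
  rw [translation_apply]
  refine Submodule.sum_mem _ fun k hk => Submodule.smul_mem _ _ ?_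
  have : ∀ k, (wedge A ^ k) x ∈ wedgeSpan n (s + k) := by
    intro k
    induction k with
    | zero => simpa using hx
    | succ k ih =>
      rw [pow_succ', Module.End.mul_apply]
      exact wedge_mem_wedgeSpan hA ih
  exact wedgeSpan_mono (by simp at hk; omega) (this k)

/-- Only the term of index l - j of the exponential moves degree j to degree l, and l!/(l - j)! is
the falling factorial. For l < j both sides are zero. -/
theorem factorial_smul_degProj_translation (A : Matrix (Fin n) (Fin n) ℂ) {j : ℕ} {v : HalfSpin n}
    (hv : degProj n j v = v) (l : ℕ) :
    (l.factorial : ℂ) • degProj n l (translation A v) =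
      (l.descFactorial j : ℂ) • (wedge A ^ (l - j)) v := by
  rw [translation_apply, map_sum]
  by_cases hjl : j ≤ l
  · have hterm : degProj n l ((wedge A ^ (l - j)) v) = (wedge A ^ (l - j)) v := by
      rw [degProj_wedge_pow, if_pos (Nat.sub_le _ _), Nat.sub_sub_self hjl, hv]
    rw [Finset.sum_eq_single (l - j)]
    · rw [map_smul, hterm, smul_smul]
      congr 1
      have := Nat.factorial_mul_descFactorial hjl
      have h0 : ((l - j).factorial : ℂ) ≠ 0 := by exact_mod_cast Nat.factorial_ne_zero _
      rw [← this]
      push_cast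
      field_simp
    · intro i _ hi
      rw [map_smul, degProj_wedge_pow]
      split_ifs with h
      · rw [← hv, degProj_degProj, if_neg (by omega), map_zero, smul_zero]
      · rw [smul_zero]
    · intro h
      -- Here l - j > n, so the term missing from the truncated sum is zero anyway.
      rw [wedge_pow_eq_zero A (N := l - j) (by simp at h; omega)]
      simp
  · rw [Nat.descFactorial_of_lt (by omega), Nat.cast_zero, zero_smul, Finset.sum_eq_zero, smul_zero]
    intro i _
    rw [map_smul, degProj_wedge_pow]
    split_ifs with h
    · rw [← hv, degProj_degProj, if_neg (by omega), map_zero, smul_zero]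
    · rw [smul_zero]

/-- This is the m-th forward difference of a polynomial of degree j < m. -/
theorem sum_choose_descFactorial_eq_zero {j m : ℕ} (hj : j < m) (k : ℕ) :
    ∑ i ∈ Finset.range (m + 1),
      ((-1 : ℂ) ^ (m - i) * m.choose i) * ((k + i).descFactorial j : ℂ) = 0 := by
  have h := congrFun (Polynomial.fwdDiff_iter_eq_zero_of_degree_lt (P := descPochhammer ℂ j)
    (n := m) (by rwa [descPochhammer_natDegree])) (k : ℂ)
  rw [fwdDiff_iter_eq_sum_shift] at h
  rw [Pi.zero_apply] at h
  rw [← h]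
  refine Finset.sum_congr rfl fun i _ => ?_
  rw [← descPochhammer_eval_eq_descFactorial, zsmul_eq_mul]
  push_cast
  simp

/-- Applying the power m - i brings each component of degree k + i to a multiple of the same vector,
with a falling factorial as coefficient; the sum is then a finite difference. -/
theorem sum_wedge_pow_degProj_translation_of_degProj_eq (A : Matrix (Fin n) (Fin n) ℂ) {j m : ℕ}
    (hj : j < m) {v : HalfSpin n} (hv : degProj n j v = v) (k : ℕ) :
    ∑ i ∈ Finset.range (m + 1), ((-1 : ℂ) ^ (m - i) * m.choose i * (k + i).factorial) •
      (wedge A ^ (m - i)) (degProj n (k + i) (translation A v)) = 0 := by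
  have h : ∀ i ∈ Finset.range (m + 1),
      ((-1 : ℂ) ^ (m - i) * m.choose i * (k + i).factorial) •
        (wedge A ^ (m - i)) (degProj n (k + i) (translation A v)) =
      (((-1 : ℂ) ^ (m - i) * m.choose i) * ((k + i).descFactorial j : ℂ)) •
        (wedge A ^ (m + k - j)) v := by
    intro i hi
    rw [mul_smul, ← map_smul, factorial_smul_degProj_translation A hv, mul_smul, map_smul]
    -- For j > k + i the truncated exponents do not add up, but the falling factorial vanishes.
    by_cases hji : j ≤ k + i
    · have he : m - i + (k + i - j) = m + k - j := by simp at hi; omega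
      rw [← Module.End.mul_apply, ← pow_add, he]
      simp only [mul_smul]
    · rw [Nat.descFactorial_of_lt (by omega)]
      simp
  rw [Finset.sum_congr rfl h, ← Finset.sum_smul, sum_choose_descFactorial_eq_zero hj, zero_smul]

/-- Because k > s₁, the summand from `wedgeSpan n s₁` has no component in the degrees involved. The
difference order s₂ + 1 exceeds the degree of every generator of `wedgeSpan n s₂`. -/
theorem sum_wedge_pow_degProj_of_mem (A : Matrix (Fin n) (Fin n) ℂ) {s₁ s₂ k : ℕ} (hk : s₁ < k)
    {y : HalfSpin n} (hy : y ∈ wedgeSpan n s₁ ⊔ (wedgeSpan n s₂).map (translation A)) :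
    ∑ i ∈ Finset.range (s₂ + 1 + 1),
      ((-1 : ℂ) ^ (s₂ + 1 - i) * (s₂ + 1).choose i * (k + i).factorial) •
        (wedge A ^ (s₂ + 1 - i)) (degProj n (k + i) y) = 0 := by
  obtain ⟨u, hu, _, ⟨v, hv, rfl⟩, rfl⟩ := Submodule.mem_sup.mp hy
  have h1 : ∀ i, degProj n (k + i) (u + translation A v) =
      degProj n (k + i) (translation A v) := fun i => by
    rw [map_add, degProj_eq_zero_of_mem_wedgeSpan hu (by omega), zero_add]
  simp only [h1]
  clear hy h1 hu
  induction hv using Submodule.span_induction with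
  | mem w hw =>
    obtain ⟨j, hj, V, hV, rfl⟩ := hw
    exact sum_wedge_pow_degProj_translation_of_degProj_eq A (by omega)
      (degProj_prod_wedge_vacuum j V) k
  | zero => simp
  | add x y _ _ hx hy => simp only [map_add, smul_add, Finset.sum_add_distrib, hx, hy, add_zero]
  | smul c x _ hx =>
    simp only [map_smul, smul_comm _ c, ← Finset.smul_sum, hx, smul_zero]

/-- Written for r t • A, the finite-difference relation has coefficients containing r t ^ (s₂ + 1 -
i). At t = 0 only the top term survives, and it kills the component of degree k + s₂ + 1 for every k
> s₁. -/
theorem mem_wedgeSpan_of_eventually {A : Matrix (Fin n) (Fin n) ℂ} (hA : A.transpose = -A)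
    {s₁ s₂ : ℕ} {y : ℂ → HalfSpin n} {r : ℂ → ℂ} (hy : ContinuousAt y 0) (hr : ContinuousAt r 0)
    (hr0 : r 0 = 0)
    (h : ∀ᶠ t in 𝓝[≠] (0 : ℂ),
      y t ∈ wedgeSpan n s₁ ⊔ (wedgeSpan n s₂).map (translation (r t • A))) :
    y 0 ∈ wedgeSpan n (s₁ + s₂ + 1) := by
  -- A crude order bound, uniform in t, passes to the limit by closedness; after that only degrees
  -- have to be controlled.
  have hbig : y 0 ∈ wedgeSpan n (s₁ + s₂ + n) := by
    refine (Submodule.closed_of_finiteDimensional _).mem_of_tendsto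
      (hy.tendsto.mono_left (nhdsWithin_le_nhds (s := {0}ᶜ))) ?_
    filter_upwards [h] with t ht
    obtain ⟨u, hu, _, ⟨v, hv, rfl⟩, huv⟩ := Submodule.mem_sup.mp ht
    rw [← huv]
    have hrA : (r t • A).transpose = -(r t • A) := by
      rw [Matrix.transpose_smul, hA, smul_neg]
    exact add_mem (wedgeSpan_mono (by omega) hu)
      (wedgeSpan_mono (by omega) (translation_mem_wedgeSpan hrA hv))
  refine mem_wedgeSpan_of_degProj_eq_zero hbig fun l hl => ?_
  obtain ⟨k, rfl⟩ : ∃ k, l = k + (s₂ + 1) := ⟨l - (s₂ + 1), by omega⟩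
  set G : ℂ → HalfSpin n := fun t => ∑ i ∈ Finset.range (s₂ + 1 + 1),
      ((-1 : ℂ) ^ (s₂ + 1 - i) * (s₂ + 1).choose i * (k + i).factorial * r t ^ (s₂ + 1 - i)) •
        (wedge A ^ (s₂ + 1 - i)) (degProj n (k + i) (y t)) with hG
  have hGc : ContinuousAt G 0 := by
    refine tendsto_finsetSum _ fun i _ => ?_
    refine ContinuousAt.smul (continuousAt_const.mul (hr.pow _)) ?_
    have hc : Continuous ((wedge A ^ (s₂ + 1 - i)) ∘ₗ degProj n (k + i)) :=
      LinearMap.continuous_of_finiteDimensional _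
    exact ContinuousAt.comp (g := (wedge A ^ (s₂ + 1 - i)) ∘ₗ degProj n (k + i))
      hc.continuousAt hy
  have hG0 : G 0 = 0 := by
    refine tendsto_nhds_unique (hGc.tendsto.mono_left (nhdsWithin_le_nhds (s := {0}ᶜ))) ?_
    refine tendsto_const_nhds.congr' ?_
    filter_upwards [h] with t ht
    rw [← sum_wedge_pow_degProj_of_mem (r t • A) (k := k) (by omega) ht]
    refine Finset.sum_congr rfl fun i _ => ?_
    rw [map_smul wedge, smul_pow, LinearMap.smul_apply, mul_smul _ (r t ^ (s₂ + 1 - i))]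
  rw [hG] at hG0
  simp only at hG0
  rw [Finset.sum_eq_single (s₂ + 1)] at hG0
  · have h0 : ((k + (s₂ + 1)).factorial : ℂ) ≠ 0 := by exact_mod_cast Nat.factorial_ne_zero _
    simpa [h0] using hG0
  · intro i hi hne
    have : s₂ + 1 - i ≠ 0 := by simp at hi; omega
    simp [hr0, this]
  · simp

end Osculation

/-! ### Existence and testing of flat limits -/

section FlatLimits

variable {ι : Type*}

/-- Evaluation of vectors of polynomials, as a semilinear map. -/
def evalVec (t : ℂ) :
    (ι → Polynomial ℂ) →ₛₗ[Polynomial.evalRingHom t] (ι → ℂ) where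
  toFun f i := (f i).eval t
  map_add' f g := by ext; simp
  map_smul' c f := by ext; simp

theorem evalVec_apply (t : ℂ) (f : ι → Polynomial ℂ) : evalVec t f = fun i => (f i).eval t := rfl

instance (t : ℂ) : RingHomSurjective (Polynomial.evalRingHom t) :=
  ⟨fun x => ⟨Polynomial.C x, by simp⟩⟩

/-- Evaluation maps polynomial vectors onto ℂ^ι, so a basis goes to a spanning family of the right
cardinality. -/
theorem linearIndependent_evalVec_basis [Fintype ι]
    (b : Module.Basis ι (Polynomial ℂ) (ι → Polynomial ℂ)) (t : ℂ) :
    LinearIndependent ℂ fun i => evalVec t (b i) := by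
  refine linearIndependent_of_top_le_span_of_card_eq_finrank ?_ (by simp)
  have h : (Submodule.span (Polynomial ℂ) (Set.range b)).map (evalVec t) =
      Submodule.span ℂ (Set.range fun i => evalVec t (b i)) := by
    rw [Submodule.map_span, ← Set.range_comp]
    rfl
  rw [← h, b.span_eq]
  intro x _
  exact ⟨fun i => Polynomial.C (x i), trivial, by ext i; simp [evalVec_apply]⟩

theorem span_range_smul_of_ne_zero {K V κ : Type*} [Field K] [AddCommGroup V] [Module K V]
    {c : κ → K} (hc : ∀ j, c j ≠ 0) (w : κ → V) :
    Submodule.span K (Set.range fun j => c j • w j) = Submodule.span K (Set.range w) := by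
  apply le_antisymm
  · rw [Submodule.span_le]
    rintro _ ⟨j, rfl⟩
    exact Submodule.smul_mem _ _ (Submodule.subset_span ⟨j, rfl⟩)
  · rw [Submodule.span_le]
    rintro _ ⟨j, rfl⟩
    have := Submodule.smul_mem (Submodule.span K (Set.range fun j => c j • w j)) (c j)⁻¹
      (Submodule.subset_span ⟨j, rfl⟩)
    rwa [inv_smul_smul₀ (hc j)] at this

/-- Over the principal ideal domain ℂ[t], the module generated by g has a basis of multiples a j • b
j of part of a basis of the ambient free module. Dropping the a j leaves a frame independent at
every t, which spans the same space wherever no a j vanishes. -/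
theorem exists_isFlatLimit [Fintype ι] {κ : Type*} {T : ℂ → Submodule ℂ (ι → ℂ)}
    (g : κ → ι → Polynomial ℂ)
    (h : ∀ᶠ t in Filter.cofinite,
      Submodule.span ℂ (Set.range fun j => evalVec t (g j)) = T t) :
    ∃ T₀, IsFlatLimit T T₀ := by
  classical
  obtain ⟨k, bM, bN, f, a, snf⟩ := (Submodule.span (Polynomial ℂ) (Set.range g)).smithNormalForm
    (Pi.basisFun (Polynomial ℂ) ι)
  refine ⟨_, k, fun j => bM (f j), ?_, rfl, ?_⟩
  · exact (linearIndependent_evalVec_basis bM 0).comp _ f.injective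
  · have ha : ∀ j, a j ≠ 0 := fun j h0 => by
      have h1 := snf j
      rw [h0, zero_smul] at h1
      exact bN.ne_zero j (Subtype.ext h1)
    have hfin : ∀ᶠ t in Filter.cofinite, ∀ j, (a j).eval t ≠ 0 := by
      rw [Filter.eventually_all]
      intro j
      exact ((a j).rootSet_finite ℂ).subset fun t ht => by
        rw [Polynomial.mem_rootSet]
        refine ⟨ha j, ?_⟩
        simpa using ht
    filter_upwards [h, hfin] with t ht hat
    rw [← ht]
    have e1 : Submodule.span ℂ (Set.range fun j => evalVec t (g j)) =
        (Submodule.span (Polynomial ℂ) (Set.range g)).map (evalVec t) := by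
      rw [Submodule.map_span, ← Set.range_comp]
      rfl
    have e2 : Submodule.span (Polynomial ℂ) (Set.range g) =
        Submodule.span (Polynomial ℂ) (Set.range fun j => a j • bM (f j)) := by
      have := congrArg (Submodule.map (Submodule.subtype _)) bN.span_eq
      rw [Submodule.map_span, ← Set.range_comp, Submodule.map_top, Submodule.range_subtype] at this
      refine this.symm.trans ?_
      congr 2
      funext j
      exact snf j
    rw [e1, e2, Submodule.map_span, ← Set.range_comp]
    have e3 : (evalVec t ∘ fun j => a j • bM (f j)) =
        fun j => (a j).eval t • evalVec t (bM (f j)) := by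
      funext j
      simp [LinearMap.map_smulₛₗ]
    rw [e3, span_range_smul_of_ne_zero hat]
    rfl

/-- Each frame vector of the limit is the value at 0 of a continuous curve lying in T t for small t
≠ 0, so containment can be tested on such curves. -/
theorem IsFlatLimit.le_of_forall [Fintype ι] {T : ℂ → Submodule ℂ (ι → ℂ)}
    {T₀ S : Submodule ℂ (ι → ℂ)} (h : IsFlatLimit T T₀)
    (hS : ∀ y : ℂ → ι → ℂ, Continuous y → (∀ᶠ t in 𝓝[≠] (0 : ℂ), y t ∈ T t) → y 0 ∈ S) :
    T₀ ≤ S := by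
  obtain ⟨k, f, -, rfl, hf⟩ := h
  rw [Submodule.span_le]
  rintro _ ⟨j, rfl⟩
  refine hS (fun t i => (f j i).eval t)
    (continuous_pi fun i => (f j i).continuous) ?_
  filter_upwards [nhdsNE_le_cofinite 0 hf] with t ht
  rw [← ht]
  exact Submodule.subset_span ⟨j, rfl⟩

end FlatLimits

/-! ### The affine chart and its image in the closure -/

section Chart

variable {n : ℕ}

theorem alpha_eq_pfaffian (A : Matrix (Fin n) (Fin n) ℂ) (I : EvenSubset n) {k : ℕ}
    (hI : I.1.card = 2 * k) :
    alpha A I = pfaffian (A.submatrix (I.1.orderEmbOfFin hI) (I.1.orderEmbOfFin hI)) := by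
  obtain rfl : k = I.1.card / 2 := by omega
  rfl

theorem pfaffian_two (A : Matrix (Fin (2 * 1)) (Fin (2 * 1)) ℂ) :
    pfaffian A = (A 0 1 - A 1 0) / 2 := by
  have hu : (Finset.univ : Finset (Equiv.Perm (Fin 2))) = {1, Equiv.swap 0 1} := by decide
  have hs : ∀ f : Equiv.Perm (Fin 2) → ℂ, ∑ σ, f σ = f 1 + f (Equiv.swap 0 1) := fun f => by
    rw [hu, Finset.sum_pair (by decide)]
  unfold pfaffian
  refine (congrArg _ (hs _)).trans ?_
  have h : (⟨2 * ((0 : Fin 1) : ℕ) + 1, by simp⟩ : Fin (2 * 1)) = 1 := rfl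
  have h' : (⟨2 * ((0 : Fin 1) : ℕ), by simp⟩ : Fin (2 * 1)) = 0 := rfl
  have e1 : (Equiv.swap (0 : Fin (2 * 1)) 1) 0 = 1 := by decide
  have e2 : (Equiv.swap (0 : Fin (2 * 1)) 1) 1 = 0 := by decide
  have e3 : Equiv.Perm.sign (Equiv.swap (0 : Fin 2) 1) = -1 := by decide
  simp only [Finset.univ_unique, Finset.prod_singleton, Fin.default_eq_zero, e3]
  simp only [h, h', e1, e2, Equiv.Perm.coe_one, id]
  simp
  ring

/-- The index `∅`. -/
def emptyIndex (n : ℕ) : EvenSubset n := ⟨∅, by simp⟩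

/-- The index `{i, j}`. -/
def pairIndex (i j : Fin n) (h : i ≠ j) : EvenSubset n :=
  ⟨{i, j}, by rw [Finset.card_pair h]; exact even_two⟩

theorem pairIndex_comm (i j : Fin n) (h : i ≠ j) : pairIndex j i h.symm = pairIndex i j h :=
  Subtype.ext (Finset.pair_comm j i)

theorem alpha_pairIndex (A : Matrix (Fin n) (Fin n) ℂ) {i j : Fin n} (h : i < j) :
    alpha A (pairIndex i j h.ne) = (A i j - A j i) / 2 := by
  have hc : (pairIndex i j h.ne).1.card = 2 * 1 := Finset.card_pair h.ne
  have hf : ![i, j] = (pairIndex i j h.ne).1.orderEmbOfFin hc := by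
    refine Finset.orderEmbOfFin_unique hc (fun x => ?_) ?_
    · fin_cases x <;> simp [pairIndex]
    · intro a b hab
      fin_cases a <;> fin_cases b <;> simp_all
  rw [alpha_eq_pfaffian A _ hc, pfaffian_two, ← hf]
  rfl

/-- The skew-symmetric matrix whose entries are the coordinates `P_{i,j}`. -/
def skewOf : HalfSpin n →ₗ[ℂ] Matrix (Fin n) (Fin n) ℂ where
  toFun x := Matrix.of fun i j =>
    if h : i = j then 0 else (if i < j then 1 else -1 : ℂ) * x (pairIndex i j h)
  map_add' x y := by ext i j; by_cases h : i = j <;> simp [h, mul_add]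
  map_smul' c x := by ext i j; by_cases h : i = j <;> simp [h, mul_left_comm]

theorem skewOf_apply (x : HalfSpin n) (i j : Fin n) :
    skewOf x i j = if h : i = j then 0 else (if i < j then 1 else -1 : ℂ) * x (pairIndex i j h) :=
  rfl

theorem skewOf_transpose (x : HalfSpin n) : (skewOf x).transpose = -skewOf x := by
  ext i j
  rw [Matrix.transpose_apply, Matrix.neg_apply, skewOf_apply, skewOf_apply]
  rcases lt_trichotomy i j with h | h | h
  · simp [h.ne, h.ne', h, h.not_gt, pairIndex_comm i j h.ne]
  · simp [h]
  · simp [h.ne, h.ne', h, h.not_gt, pairIndex_comm i j h.ne']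

theorem skewOf_alpha {A : Matrix (Fin n) (Fin n) ℂ} (hA : A.transpose = -A) :
    skewOf (alpha A) = A := by
  have hs : ∀ i j, A j i = -A i j := fun i j => congrFun (congrFun hA i) j
  ext i j
  rw [skewOf_apply]
  rcases lt_trichotomy i j with h | h | h
  · rw [dif_neg h.ne, if_pos h, alpha_pairIndex A h, hs i j]; ring
  · subst h
    have := hs i i
    simp only [dif_pos]
    exact (self_eq_neg.mp this).symm
  · rw [dif_neg h.ne', if_neg h.not_gt, ← pairIndex_comm, alpha_pairIndex A h, hs i j]; ring

theorem pfaffian_smul {k : ℕ} (t : ℂ) (A : Matrix (Fin (2 * k)) (Fin (2 * k)) ℂ) :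
    pfaffian (t • A) = t ^ k * pfaffian A := by
  unfold pfaffian
  simp only [Matrix.smul_apply, smul_eq_mul, Finset.prod_mul_distrib, Finset.prod_const,
    Finset.card_univ, Fintype.card_fin, Finset.mul_sum]
  exact Finset.sum_congr rfl fun σ _ => by ring

theorem alpha_smul (t : ℂ) (A : Matrix (Fin n) (Fin n) ℂ) (I : EvenSubset n) :
    alpha (t • A) I = t ^ (I.1.card / 2) * alpha A I := by
  have hI := (Nat.two_mul_div_two_of_even I.2).symm
  rw [alpha_eq_pfaffian _ I hI, alpha_eq_pfaffian _ I hI, ← pfaffian_smul]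
  rfl

/-- The principal Pfaffian as a polynomial in the entries of a matrix. -/
def pfaffianPoly (I : EvenSubset n) : MvPolynomial (Fin n × Fin n) ℂ :=
  MvPolynomial.C ((2 : ℂ) ^ (I.1.card / 2) * ((I.1.card / 2).factorial : ℂ))⁻¹ *
    ∑ σ : Equiv.Perm (Fin (2 * (I.1.card / 2))), MvPolynomial.C ((Equiv.Perm.sign σ : ℤ) : ℂ) *
      ∏ i : Fin (I.1.card / 2), MvPolynomial.X
        (I.1.orderEmbOfFin (Nat.two_mul_div_two_of_even I.2).symm (σ ⟨2 * i, by omega⟩),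
         I.1.orderEmbOfFin (Nat.two_mul_div_two_of_even I.2).symm (σ ⟨2 * i + 1, by omega⟩))

theorem eval_pfaffianPoly (I : EvenSubset n) (A : Matrix (Fin n) (Fin n) ℂ) :
    MvPolynomial.eval (fun p => A p.1 p.2) (pfaffianPoly I) = alpha A I := by
  simp only [pfaffianPoly, map_mul, map_sum, map_prod, MvPolynomial.eval_C, MvPolynomial.eval_X]
  rfl

theorem isHomogeneous_pfaffianPoly (I : EvenSubset n) :
    (pfaffianPoly I).IsHomogeneous (I.1.card / 2) := by
  unfold pfaffianPoly
  refine MvPolynomial.IsHomogeneous.C_mul ?_ _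
  refine MvPolynomial.IsHomogeneous.sum _ _ _ fun σ _ => ?_
  refine MvPolynomial.IsHomogeneous.C_mul ?_ _
  have := MvPolynomial.IsHomogeneous.prod (R := ℂ) (Finset.univ : Finset (Fin (I.1.card / 2)))
    (fun i => MvPolynomial.X
        (I.1.orderEmbOfFin (Nat.two_mul_div_two_of_even I.2).symm (σ ⟨2 * i, by omega⟩),
         I.1.orderEmbOfFin (Nat.two_mul_div_two_of_even I.2).symm (σ ⟨2 * i + 1, by omega⟩)))
    (fun _ => 1) (fun i _ => MvPolynomial.isHomogeneous_X _ _)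
  simpa using this

theorem _root_.MvPolynomial.IsHomogeneous.eval_smul {σ R : Type*} [Fintype σ] [CommRing R]
    {F : MvPolynomial σ R} {d : ℕ} (hF : F.IsHomogeneous d) (c : R) (x : σ → R) :
    MvPolynomial.eval (c • x) F = c ^ d * MvPolynomial.eval x F := by
  rw [MvPolynomial.eval_eq', MvPolynomial.eval_eq', Finset.mul_sum]
  refine Finset.sum_congr rfl fun m hm => ?_
  have hd : ∑ i, m i = d := by
    rw [hF.degree_eq_sum_deg_support hm]
    exact (Finset.sum_subset (Finset.subset_univ _) (by simp)).symm
  simp only [Pi.smul_apply, smul_eq_mul, mul_pow, Finset.prod_mul_distrib,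
    Finset.prod_pow_eq_pow_sum, hd]
  ring

/-- Homogeneity makes the vanishing independent of the representative `rep` used in the definition.
-/
theorem mk_mem_spinorVariety_iff {x : HalfSpin n} (hx : x ≠ 0) :
    Projectivization.mk ℂ x hx ∈ spinorVariety n ↔
      ∀ (d : ℕ) (F : MvPolynomial (EvenSubset n) ℂ), F.IsHomogeneous d →
        (∀ A : Matrix (Fin n) (Fin n) ℂ, A.transpose = -A → MvPolynomial.eval (alpha A) F = 0) →
        MvPolynomial.eval x F = 0 := by
  obtain ⟨a, ha⟩ := Projectivization.exists_smul_eq_mk_rep ℂ x hx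
  refine forall_congr' fun d => forall_congr' fun F => forall_congr' fun hF => imp_congr_right ?_
  intro _
  rw [← ha, Units.smul_def, hF.eval_smul]
  simp

theorem mk_alpha_mem {A : Matrix (Fin n) (Fin n) ℂ} (hA : A.transpose = -A) :
    Projectivization.mk ℂ (alpha A) (alpha_ne_zero A) ∈ spinorVariety n :=
  (mk_mem_spinorVariety_iff _).mpr fun _ _ _ h => h A hA

/-- The entries of `skewOf` as linear forms. -/
def skewEntry (p : Fin n × Fin n) : MvPolynomial (EvenSubset n) ℂ :=
  if h : p.1 = p.2 then 0 else MvPolynomial.C (if p.1 < p.2 then 1 else -1 : ℂ) *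
    MvPolynomial.X (pairIndex p.1 p.2 h)

theorem eval_skewEntry (x : HalfSpin n) (p : Fin n × Fin n) :
    MvPolynomial.eval x (skewEntry p) = skewOf x p.1 p.2 := by
  rw [skewEntry, skewOf_apply]
  split_ifs <;> simp

theorem isHomogeneous_skewEntry (p : Fin n × Fin n) : (skewEntry p).IsHomogeneous 1 := by
  rw [skewEntry]
  split_ifs
  · exact MvPolynomial.isHomogeneous_zero _ _ _
  all_goals exact MvPolynomial.IsHomogeneous.C_mul (MvPolynomial.isHomogeneous_X _ _) _

theorem eval_aeval_pfaffianPoly {κ : Type*} (I : EvenSubset n)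
    (N : Fin n × Fin n → MvPolynomial κ ℂ) (x : κ → ℂ) :
    MvPolynomial.eval x (MvPolynomial.aeval N (pfaffianPoly I)) =
      alpha (Matrix.of fun i j => MvPolynomial.eval x (N (i, j))) I := by
  simp only [pfaffianPoly, map_mul, map_sum, map_prod, MvPolynomial.aeval_C,
    MvPolynomial.algebraMap_eq, MvPolynomial.eval_C, MvPolynomial.aeval_X]
  rfl

/-- Taking the closure adds no point with P_∅ ≠ 0: the homogenised equations expressing P_I as a
Pfaffian in the P_{i,j} hold on the image of `alpha`, hence on the closure. -/
theorem eq_smul_alpha_of_mem {x : HalfSpin n} (hx : x ∈ affineCone (spinorVariety n))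
    (h0 : x (emptyIndex n) ≠ 0) :
    x = x (emptyIndex n) • alpha ((x (emptyIndex n))⁻¹ • skewOf x) := by
  obtain ⟨hx0, hmem⟩ := hx
  rw [mk_mem_spinorVariety_iff] at hmem
  ext I
  set k := I.1.card / 2 with hk
  -- The additional factor P_∅ on the Pfaffian term makes both terms homogeneous of degree k + 1.
  have h := hmem (k + 1)
    (MvPolynomial.X (emptyIndex n) ^ k * MvPolynomial.X I -
      MvPolynomial.aeval skewEntry (pfaffianPoly I) * MvPolynomial.X (emptyIndex n)) ?_ ?_
  · rw [map_sub, map_mul, map_mul, map_pow, MvPolynomial.eval_X, MvPolynomial.eval_X,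
      eval_aeval_pfaffianPoly] at h
    have e : (Matrix.of fun i j => MvPolynomial.eval x (skewEntry (i, j))) = skewOf x := by
      ext i j
      rw [Matrix.of_apply, eval_skewEntry]
    rw [e] at h
    rw [Pi.smul_apply, alpha_smul, smul_eq_mul, ← hk, inv_pow]
    field_simp
    linear_combination h
  · refine MvPolynomial.IsHomogeneous.sub ?_ ?_
    · simpa using ((MvPolynomial.isHomogeneous_X ℂ (emptyIndex n)).pow k).mul
        (MvPolynomial.isHomogeneous_X ℂ I)
    · refine MvPolynomial.IsHomogeneous.mul ?_ (MvPolynomial.isHomogeneous_X _ _)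
      simpa using (isHomogeneous_pfaffianPoly I).aeval skewEntry isHomogeneous_skewEntry
  · intro A hA
    rw [map_sub, map_mul, map_mul, map_pow, MvPolynomial.eval_X, MvPolynomial.eval_X,
      eval_aeval_pfaffianPoly]
    have e : (Matrix.of fun i j => MvPolynomial.eval (alpha A) (skewEntry (i, j))) = A := by
      ext i j
      rw [Matrix.of_apply, eval_skewEntry, skewOf_alpha hA]
    have e0 : alpha A (emptyIndex n) = 1 := alpha_empty A
    rw [e, e0]
    simp

end Chart

/-! ### Vanishing order under composition and multiplication -/

section VanishingOrder

variable {E F : Type*} [NormedAddCommGroup E] [NormedSpace ℂ E] [NormedAddCommGroup F]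
  [NormedSpace ℂ F] [CompleteSpace F]

/-- If the derivatives of `f` of order at most `s` vanish at `h x`, so do those of `g * (f ∘ h)`
at `x`. -/
theorem iteratedFDeriv_mul_comp_eq_zero {f : F → ℂ} {g : E → ℂ} {h : E → F} {x : E} {s : ℕ}
    (hf : ∀ y, AnalyticAt ℂ f y) (hg : AnalyticAt ℂ g x) (hh : AnalyticAt ℂ h x)
    (hz : ∀ i ≤ s, iteratedFDeriv ℂ i f (h x) = 0) {k : ℕ} (hk : k ≤ s) :
    iteratedFDeriv ℂ k (fun u => g u * f (h u)) x = 0 := by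
  obtain ⟨U, hU, hUo, hxU⟩ := eventually_nhds_iff.mp
    (hg.eventually_analyticAt.and hh.eventually_analyticAt)
  have hgU : ContDiffOn ℂ k g U := fun u hu => (hU u hu).1.contDiffAt.contDiffWithinAt
  have hhU : ContDiffOn ℂ k h U := fun u hu => (hU u hu).2.contDiffAt.contDiffWithinAt
  have hfU : ContDiffOn ℂ k f Set.univ := fun u _ => (hf u).contDiffAt.contDiffWithinAt
  have hcomp : ∀ j ≤ k, iteratedFDerivWithin ℂ j (f ∘ h) U x = 0 := by
    intro j hj
    -- The composition bound is multiplied by C = 0, so any D bounding the derivatives of h serves;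
    -- the summand 1 gives D ≤ D ^ i for i ≥ 1.
    set D : ℝ := 1 + ∑ i ∈ Finset.range (j + 1), ‖iteratedFDerivWithin ℂ i h U x‖ with hD
    have hb := norm_iteratedFDerivWithin_comp_le (n := j) hfU hhU (by exact_mod_cast hj)
      uniqueDiffOn_univ hUo.uniqueDiffOn (Set.mapsTo_univ _ _) hxU (C := 0) (D := D)
      (fun i hi => by
        rw [iteratedFDerivWithin_univ, hz i (hi.trans (hj.trans hk)), norm_zero])
      (fun i h1 hi => by
        have hle : ‖iteratedFDerivWithin ℂ i h U x‖ ≤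
            ∑ i ∈ Finset.range (j + 1), ‖iteratedFDerivWithin ℂ i h U x‖ :=
          Finset.single_le_sum (f := fun i => ‖iteratedFDerivWithin ℂ i h U x‖)
            (fun _ _ => norm_nonneg _) (Finset.mem_range.mpr (by omega))
        have hD1 : 1 ≤ D := by
          rw [hD]
          have : 0 ≤ ∑ i ∈ Finset.range (j + 1), ‖iteratedFDerivWithin ℂ i h U x‖ :=
            Finset.sum_nonneg fun _ _ => norm_nonneg _
          linarith
        exact (by linarith : _ ≤ D).trans (le_self_pow₀ hD1 (by omega)))
    rw [mul_zero, zero_mul] at hb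
    exact norm_le_zero_iff.mp hb
  have hfh : ContDiffOn ℂ k (f ∘ h) U := hfU.comp hhU (Set.mapsTo_univ _ _)
  have hm := norm_iteratedFDerivWithin_mul_le (n := k) hgU hfh hUo.uniqueDiffOn hxU le_rfl
  rw [Finset.sum_eq_zero, iteratedFDerivWithin_of_isOpen k hUo hxU] at hm
  · exact norm_le_zero_iff.mp hm
  · intro i _
    rw [hcomp (k - i) (Nat.sub_le _ _), norm_zero, mul_zero]

end VanishingOrder

/-! ### Local parametrizations and osculating spaces -/

section Parametrization

variable {n : ℕ}

/-- The space of skew-symmetric matrices. -/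
def skewSubmodule (n : ℕ) : Submodule ℂ (Matrix (Fin n) (Fin n) ℂ) where
  carrier := {A | A.transpose = -A}
  add_mem' {A B} hA hB := by
    simp only [Set.mem_ofPred_eq] at *
    rw [Matrix.transpose_add, hA, hB, neg_add]
  zero_mem' := by simp
  smul_mem' c A hA := by
    simp only [Set.mem_ofPred_eq] at *
    rw [Matrix.transpose_smul, hA, smul_neg]

/-- The dimension of the space of skew-symmetric matrices. -/
abbrev skewDim (n : ℕ) : ℕ := Module.finrank ℂ (skewSubmodule n)

/-- Coordinates on the space of skew-symmetric matrices. -/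
def skewEquiv (n : ℕ) : skewSubmodule n ≃ₗ[ℂ] (Fin (skewDim n) → ℂ) :=
  (Module.finBasis ℂ (skewSubmodule n)).equivFun

/-- The skew-symmetric matrix with given coordinates. -/
def skewMat (n : ℕ) : (Fin (skewDim n) → ℂ) →ₗ[ℂ] Matrix (Fin n) (Fin n) ℂ :=
  (skewSubmodule n).subtype ∘ₗ (skewEquiv n).symm.toLinearMap

theorem skewMat_transpose (u : Fin (skewDim n) → ℂ) :
    (skewMat n u).transpose = -skewMat n u := ((skewEquiv n).symm u).2

/-- The coordinates of the skew-symmetric matrix `skewOf x`. -/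
def skewCoord (n : ℕ) : HalfSpin n →L[ℂ] (Fin (skewDim n) → ℂ) :=
  LinearMap.toContinuousLinearMap ((skewEquiv n).toLinearMap ∘ₗ
    (skewOf.codRestrict (skewSubmodule n) skewOf_transpose))

theorem skewMat_skewCoord (x : HalfSpin n) : skewMat n (skewCoord n x) = skewOf x := by
  simp [skewMat, skewCoord]
  rfl

theorem skewMat_injective : Function.Injective (skewMat n) :=
  Subtype.val_injective.comp (skewEquiv n).symm.injective

theorem skewMat_skewCoord_alpha {A : Matrix (Fin n) (Fin n) ℂ} (hA : A.transpose = -A) :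
    skewMat n (skewCoord n (alpha A)) = A := by
  rw [skewMat_skewCoord, skewOf_alpha hA]

theorem skew_add {A B : Matrix (Fin n) (Fin n) ℂ} (hA : A.transpose = -A)
    (hB : B.transpose = -B) : (A + B).transpose = -(A + B) :=
  (skewSubmodule n).add_mem (x := A) hA hB

theorem skew_smul {A : Matrix (Fin n) (Fin n) ℂ} (hA : A.transpose = -A) (c : ℂ) :
    (c • A).transpose = -(c • A) :=
  (skewSubmodule n).smul_mem (x := A) c hA

/-- The standard chart of the Spinor variety around `[alpha B]`. -/
def chart (B : Matrix (Fin n) (Fin n) ℂ) (u : Fin (skewDim n) → ℂ) : HalfSpin n :=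
  alpha (B + skewMat n u)

theorem chart_zero (B : Matrix (Fin n) (Fin n) ℂ) : chart B 0 = alpha B := by
  rw [chart, map_zero, add_zero]

theorem analyticAt_chart (B : Matrix (Fin n) (Fin n) ℂ) (u : Fin (skewDim n) → ℂ) :
    AnalyticAt ℂ (chart B) u := by
  rw [analyticAt_pi_iff]
  intro I
  have h : (fun u => chart B u I) = fun u => MvPolynomial.aeval
      (fun p : Fin n × Fin n => (B + skewMat n u) p.1 p.2) (pfaffianPoly I) := by
    funext u
    exact (eval_pfaffianPoly I _).symm
  rw [h]
  refine AnalyticAt.aeval_mvPolynomial (fun p => ?_) _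
  have h2 : AnalyticAt ℂ (LinearMap.toContinuousLinearMap
      (Matrix.entryLinearMap ℂ ℂ p.1 p.2 ∘ₗ skewMat n)) u := ContinuousLinearMap.analyticAt _ _
  exact analyticAt_const.add h2

theorem contDiff_chart (B : Matrix (Fin n) (Fin n) ℂ) {N : WithTop ℕ∞} : ContDiff ℂ N (chart B) :=
  contDiff_iff_contDiffAt.mpr fun u => (analyticAt_chart B u).contDiffAt

theorem hasDerivAt_translation_smul (V : Matrix (Fin n) (Fin n) ℂ) (x : HalfSpin n) :
    HasDerivAt (fun t : ℂ => translation (t • V) x) (wedge V x) 0 := by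
  have h : (fun t : ℂ => translation (t • V) x) = fun t =>
      ∑ k ∈ Finset.range (n + 2), t ^ k • ((k.factorial : ℂ)⁻¹ • (wedge V ^ k) x) := by
    funext t
    -- With n + 2 terms the index 1, which carries the derivative, lies in the range even for n = 0.
    rw [translation_eq_sum _ x (N := n + 2) (by omega)]
    refine Finset.sum_congr rfl fun k _ => ?_
    rw [map_smul wedge, smul_pow, LinearMap.smul_apply, smul_comm]
  rw [h]
  have h2 : HasDerivAt (fun t : ℂ => ∑ k ∈ Finset.range (n + 2),
      t ^ k • ((k.factorial : ℂ)⁻¹ • (wedge V ^ k) x))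
      (∑ k ∈ Finset.range (n + 2), (k * (0 : ℂ) ^ (k - 1)) •
        ((k.factorial : ℂ)⁻¹ • (wedge V ^ k) x)) 0 :=
    HasDerivAt.fun_sum fun k _ => (hasDerivAt_pow k 0).smul_const _
  convert h2 using 1
  rw [Finset.sum_eq_single 1]
  · simp
  · intro k _ hk
    rcases k with _ | _ | k
    · simp
    · exact absurd rfl hk
    · simp
  · simp

/-- Moving the parameter by t • v multiplies the chart by a one-parameter group of translations,
whose generator is the wedge operator. -/
theorem fderiv_chart (B : Matrix (Fin n) (Fin n) ℂ) (u v : Fin (skewDim n) → ℂ) :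
    fderiv ℂ (chart B) u v = wedge (skewMat n v) (chart B u) := by
  have h1 := (analyticAt_chart B u).differentiableAt.hasFDerivAt.hasLineDerivAt v
  have h2 : HasLineDerivAt ℂ (chart B) (wedge (skewMat n v) (chart B u)) u v := by
    have := hasDerivAt_translation_smul (skewMat n v) (chart B u)
    have he : (fun t : ℂ => chart B (u + t • v)) =
        fun t => translation (t • skewMat n v) (chart B u) := by
      funext t
      rw [chart, chart, ← alpha_add, map_add, map_smul, ← add_assoc, add_comm]
    unfold HasLineDerivAt
    rw [he]
    exact this
  exact h1.unique h2

theorem iteratedFDeriv_chart (B : Matrix (Fin n) (Fin n) ℂ) (k : ℕ) (u : Fin (skewDim n) → ℂ)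
    (v : Fin k → Fin (skewDim n) → ℂ) :
    iteratedFDeriv ℂ k (chart B) u v =
      (List.ofFn fun i => wedge (skewMat n (v i))).prod (chart B u) := by
  induction k generalizing u with
  | zero => simp
  | succ k ih =>
    rw [iteratedFDeriv_succ_apply_left, ← fderiv_continuousMultilinear_apply_const_apply]
    · set Q := (List.ofFn fun i => wedge (skewMat n (Fin.tail v i))).prod with hQ
      have h : (fun y => (iteratedFDeriv ℂ k (chart B) y) (Fin.tail v)) =
          fun y => LinearMap.toContinuousLinearMap Q (chart B y) := by
        funext y
        exact ih y _
      have hfd := ((LinearMap.toContinuousLinearMap Q).hasFDerivAt.comp u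
        (analyticAt_chart B u).differentiableAt.hasFDerivAt).fderiv
      change fderiv ℂ (fun y => LinearMap.toContinuousLinearMap Q (chart B y)) u = _ at hfd
      rw [h, hfd, ContinuousLinearMap.comp_apply, fderiv_chart, LinearMap.coe_toContinuousLinearMap',
        ← Module.End.mul_apply, List.ofFn_succ, List.prod_cons]
      -- Differentiation puts the new factor on the right of Q, while the product has it in front.
      have hc : Commute (wedge (skewMat n (v 0))) Q := by
        refine Commute.list_prod_right _ _ fun y hy => ?_
        obtain ⟨i, rfl⟩ := (List.mem_ofFn' _ _).mp hy
        exact commute_wedge _ _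
      rw [← hc.eq]
      rfl
    · exact (contDiff_chart B (N := (k + 1 : ℕ))).differentiable_iteratedFDeriv
        (by exact_mod_cast Nat.lt_succ_self k) u

theorem iteratedFDeriv_chart_zero (B : Matrix (Fin n) (Fin n) ℂ) (k : ℕ)
    (v : Fin k → Fin (skewDim n) → ℂ) :
    iteratedFDeriv ℂ k (chart B) 0 v =
      translation B ((List.ofFn fun i => wedge (skewMat n (v i))).prod (vacuum n)) := by
  rw [iteratedFDeriv_chart, chart_zero, alpha_eq_translation_vacuum, ← Module.End.mul_apply,
    ← Module.End.mul_apply]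
  have hc : Commute (List.ofFn fun i => wedge (skewMat n (v i))).prod (translation B) := by
    refine Commute.list_prod_left _ _ fun y hy => ?_
    obtain ⟨i, rfl⟩ := (List.mem_ofFn' _ _).mp hy
    exact commute_wedge_translation _ _
  rw [hc.eq]

theorem eq_smul_chart_of_mem {B : Matrix (Fin n) (Fin n) ℂ} (hB : B.transpose = -B)
    {x : HalfSpin n} (hx : x ∈ affineCone (spinorVariety n)) (h0 : x (emptyIndex n) ≠ 0) :
    x = x (emptyIndex n) • chart B ((x (emptyIndex n))⁻¹ • skewCoord n x -
      skewCoord n (alpha B)) := by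
  conv_lhs => rw [eq_smul_alpha_of_mem hx h0]
  rw [chart, map_sub, map_smul, skewMat_skewCoord, skewMat_skewCoord_alpha hB, add_sub_cancel]

theorem skewCoord_chart {B : Matrix (Fin n) (Fin n) ℂ} (hB : B.transpose = -B)
    (u : Fin (skewDim n) → ℂ) : skewCoord n (chart B u) = skewCoord n (alpha B) + u := by
  apply skewMat_injective
  rw [chart, skewMat_skewCoord_alpha (skew_add hB (skewMat_transpose u)), map_add,
    skewMat_skewCoord_alpha hB]

theorem chart_emptyIndex (B : Matrix (Fin n) (Fin n) ℂ) (u : Fin (skewDim n) → ℂ) :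
    chart B u (emptyIndex n) = 1 := alpha_empty _

/-- Once P_∅ is normalised to 1, the entries P_{i,j} recover the parameter; this yields both the
immersion and the neighbourhood condition. -/
theorem isLocalParametrization_chart {B : Matrix (Fin n) (Fin n) ℂ} (hB : B.transpose = -B) :
    IsLocalParametrization (spinorVariety n) (Projectivization.mk ℂ (alpha B) (alpha_ne_zero B))
      (chart B) where
  analytic := analyticAt_chart B 0
  base_eq := by rw [Projectivization.submodule_mk, chart_zero]
  mem_cone := Filter.Eventually.of_forall fun u =>
    ⟨alpha_ne_zero _, mk_alpha_mem (skew_add hB (skewMat_transpose u))⟩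
  immersion v hv := by
    obtain ⟨c, hc⟩ := Submodule.mem_span_singleton.mp hv
    -- A linear left inverse of the chart: subtracting P_∅ times the coordinates of B acts as a
    -- constant shift because P_∅ = 1 on the chart. It kills `chart B 0`, hence its whole span.
    set P : HalfSpin n →L[ℂ] (Fin (skewDim n) → ℂ) := skewCoord n -
      (ContinuousLinearMap.proj (R := ℂ) (φ := fun _ : EvenSubset n => ℂ)
        (emptyIndex n)).smulRight (skewCoord n (alpha B)) with hP
    have hPc : ∀ u, P (chart B u) = u := fun u => by
      rw [hP, sub_apply, ContinuousLinearMap.smulRight_apply,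
        ContinuousLinearMap.proj_apply, chart_emptyIndex, one_smul, skewCoord_chart hB,
        add_sub_cancel_left]
    have hd : HasFDerivAt (fun u => P (chart B u)) (P.comp (fderiv ℂ (chart B) 0)) 0 :=
      P.hasFDerivAt.comp 0 (analyticAt_chart B 0).differentiableAt.hasFDerivAt
    simp only [hPc] at hd
    have he := hd.unique (hasFDerivAt_id 0)
    have := congrArg (fun L => L v) he
    simp only [ContinuousLinearMap.comp_apply, ContinuousLinearMap.id_apply] at this
    rw [← this, ← hc, map_smul, hPc, smul_zero]
  nhds_image U hU := by
    have hcont : ContinuousAt (fun x : HalfSpin n => (x (emptyIndex n))⁻¹ • skewCoord n x -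
        skewCoord n (alpha B)) (chart B 0) := by
      refine ContinuousAt.sub (ContinuousAt.smul (ContinuousAt.inv₀
        (continuous_apply _).continuousAt ?_) (skewCoord n).continuous.continuousAt)
        continuousAt_const
      rw [chart_emptyIndex]
      exact one_ne_zero
    have hne : ∀ᶠ x : HalfSpin n in 𝓝 (chart B 0), x (emptyIndex n) ≠ 0 := by
      refine (continuous_apply (emptyIndex n)).continuousAt.eventually_ne ?_
      rw [chart_emptyIndex]
      exact one_ne_zero
    have hval : (chart B 0 (emptyIndex n))⁻¹ • skewCoord n (chart B 0) -
        skewCoord n (alpha B) = 0 := by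
      rw [chart_emptyIndex, inv_one, one_smul, chart_zero, sub_self]
    have hU' := hcont.preimage_mem_nhds (t := U) (by rwa [hval])
    refine eventually_nhdsWithin_iff.mpr ?_
    filter_upwards [hne, hU'] with x hx0 hxU hxX
    exact ⟨_, _, hxU, eq_smul_chart_of_mem hB hxX hx0⟩

/-- Any local parametrization is an analytic scalar times the standard chart composed with an
analytic change of parameters. A linear form killing the derivatives of the chart up to order s
therefore kills those of φ. -/
theorem iteratedFDeriv_mem_of_isLocalParametrization {B : Matrix (Fin n) (Fin n) ℂ}
    (hB : B.transpose = -B) {d : ℕ} {φ : (Fin d → ℂ) → HalfSpin n}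
    (hφ : IsLocalParametrization (spinorVariety n)
      (Projectivization.mk ℂ (alpha B) (alpha_ne_zero B)) φ) {k s : ℕ} (hk : k ≤ s)
    (v : Fin k → Fin d → ℂ) :
    iteratedFDeriv ℂ k φ 0 v ∈ (wedgeSpan n s).map (translation B) := by
  by_contra hnot
  -- Separate the derivative from the subspace by a linear form, so that membership becomes a
  -- vanishing order.
  obtain ⟨l, hl, hker⟩ := Submodule.exists_le_ker_of_notMem hnot
  set ℓ := LinearMap.toContinuousLinearMap l with hℓ
  have hbase : ∃ c : ℂ, c • alpha B = φ 0 := by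
    have := hφ.base_eq
    rw [Projectivization.submodule_mk] at this
    exact Submodule.mem_span_singleton.mp (this ▸ Submodule.mem_span_singleton_self _)
  obtain ⟨c, hc⟩ := hbase
  have hc0 : c ≠ 0 := by
    rintro rfl
    obtain ⟨h0, -⟩ := hφ.mem_cone.self_of_nhds
    exact h0 (by rw [← hc, zero_smul])
  have hcempty : φ 0 (emptyIndex n) = c := by
    rw [← hc, Pi.smul_apply, show alpha B (emptyIndex n) = 1 from alpha_empty B, smul_eq_mul,
      mul_one]
  have hg : AnalyticAt ℂ (fun u => φ u (emptyIndex n)) 0 :=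
    (analyticAt_pi_iff.mp hφ.analytic) _
  have hne : ∀ᶠ u in 𝓝 0, φ u (emptyIndex n) ≠ 0 :=
    hg.continuousAt.eventually_ne (by rwa [hcempty])
  set h : (Fin d → ℂ) → Fin (skewDim n) → ℂ := fun u =>
    (φ u (emptyIndex n))⁻¹ • skewCoord n (φ u) - skewCoord n (alpha B) with hh
  have hha : AnalyticAt ℂ h 0 := by
    refine AnalyticAt.sub (AnalyticAt.smul (hg.inv (by rwa [hcempty])) ?_) analyticAt_const
    exact ((skewCoord n).analyticAt _).comp hφ.analytic
  have hh0 : h 0 = 0 := by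
    rw [hh]
    simp only [hcempty]
    rw [← hc, map_smul, inv_smul_smul₀ hc0, sub_self]
  have hev : (fun u => ℓ (φ u)) =ᶠ[𝓝 0]
      fun u => φ u (emptyIndex n) * (fun w => ℓ (chart B w)) (h u) := by
    filter_upwards [hne, hφ.mem_cone] with u hu hX
    conv_lhs => rw [eq_smul_chart_of_mem hB hX hu]
    rw [map_smul, smul_eq_mul]
  have hz : ∀ i ≤ s, iteratedFDeriv ℂ i (fun w => ℓ (chart B w)) (h 0) = 0 := by
    intro i hi
    rw [hh0]
    have := ContinuousLinearMap.iteratedFDeriv_comp_left ℓ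
      (contDiff_chart B (N := i)).contDiffAt (x := 0) (i := i) le_rfl
    change iteratedFDeriv ℂ i (ℓ ∘ chart B) 0 = 0
    rw [this]
    ext w
    rw [ContinuousLinearMap.compContinuousMultilinearMap_coe, Function.comp_apply,
      iteratedFDeriv_chart_zero]
    exact hker ⟨_, Submodule.subset_span ⟨i, hi, _, fun j => skewMat_transpose _, rfl⟩, rfl⟩
  have hzero := iteratedFDeriv_mul_comp_eq_zero
    (fun y => (ℓ.analyticAt _).comp (analyticAt_chart B y)) hg hha hz hk
  have hφz : iteratedFDeriv ℂ k (ℓ ∘ φ) 0 = 0 :=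
    ((hev.iteratedFDeriv ℂ k).self_of_nhds).trans hzero
  rw [ContinuousLinearMap.iteratedFDeriv_comp_left ℓ
    (hφ.analytic.contDiffAt (n := k)) (i := k) le_rfl] at hφz
  exact hl (congrArg (fun L => L v) hφz)

/-- The osculating spaces of the Spinor variety at the points of the affine chart. -/
theorem osculatingSpace_alpha {B : Matrix (Fin n) (Fin n) ℂ} (hB : B.transpose = -B) (s : ℕ) :
    osculatingSpace (spinorVariety n) (Projectivization.mk ℂ (alpha B) (alpha_ne_zero B)) s =
      (wedgeSpan n s).map (translation B) := by
  apply le_antisymm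
  · rw [osculatingSpace, Submodule.span_le]
    rintro _ ⟨d, φ, hφ, k, hk, v, rfl⟩
    exact iteratedFDeriv_mem_of_isLocalParametrization hB hφ hk v
  · rw [wedgeSpan, Submodule.map_span, Submodule.span_le]
    rintro _ ⟨_, ⟨k, hk, V, hV, rfl⟩, rfl⟩
    -- The entries of V i are read off from alpha (V i), so these are the chart coordinates of V i.
    refine Submodule.subset_span ⟨_, chart B, isLocalParametrization_chart hB, k, hk,
      fun i => skewCoord n (alpha (V i)), ?_⟩
    rw [iteratedFDeriv_chart_zero]
    simp only [skewMat_skewCoord_alpha (hV _)]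

end Parametrization

/-! ### Powers of a bivector and the rank of the matrix -/

section Nonvanishing

variable {n : ℕ}

open CliffordAlgebra in
theorem contractLeft_mem {φ : Module.Dual ℂ (Fin n → ℂ)} (k : ℕ)
    {x : ExteriorAlgebra ℂ (Fin n → ℂ)} (hx : x ∈ ⋀[ℂ]^(k + 1) (Fin n → ℂ)) :
    contractLeft (Q := (0 : QuadraticForm ℂ (Fin n → ℂ))) φ x ∈ ⋀[ℂ]^k (Fin n → ℂ) := by
  induction k generalizing x with
  | zero =>
    rw [ExteriorAlgebra.exteriorPower, zero_add, pow_one] at hx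
    obtain ⟨a, rfl⟩ := hx
    rw [ExteriorAlgebra.exteriorPower, pow_zero]
    have : contractLeft (Q := (0 : QuadraticForm ℂ (Fin n → ℂ))) φ (ExteriorAlgebra.ι ℂ a) =
        algebraMap ℂ _ (φ a) := contractLeft_ι _ φ a
    rw [this]
    exact Submodule.algebraMap_mem _
  | succ k ih =>
    rw [ExteriorAlgebra.exteriorPower, pow_succ'] at hx
    induction hx using Submodule.mul_induction_on' with
    | mem_mul_mem a ha b hb =>
      obtain ⟨a, rfl⟩ := ha
      have : contractLeft (Q := (0 : QuadraticForm ℂ (Fin n → ℂ))) φ (ExteriorAlgebra.ι ℂ a * b) =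
          φ a • b - ExteriorAlgebra.ι ℂ a *
            contractLeft (Q := (0 : QuadraticForm ℂ (Fin n → ℂ))) φ b := contractLeft_ι_mul _ a b
      rw [this]
      refine Submodule.sub_mem _ (Submodule.smul_mem _ _ hb) ?_
      rw [ExteriorAlgebra.exteriorPower, pow_succ']
      exact Submodule.mul_mem_mul ⟨a, rfl⟩ (ih hb)
    | add x _ y _ hx hy => rw [map_add]; exact add_mem hx hy

/-- Contraction of an element of the exterior algebra with a linear form. -/
def contract (φ : Module.Dual ℂ (Fin n → ℂ)) :
    Module.End ℂ (ExteriorAlgebra ℂ (Fin n → ℂ)) :=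
  CliffordAlgebra.contractLeft (Q := (0 : QuadraticForm ℂ (Fin n → ℂ))) φ

theorem contract_ι_mul (φ : Module.Dual ℂ (Fin n → ℂ)) (a : Fin n → ℂ)
    (b : ExteriorAlgebra ℂ (Fin n → ℂ)) :
    contract φ (ExteriorAlgebra.ι ℂ a * b) =
      φ a • b - ExteriorAlgebra.ι ℂ a * contract φ b :=
  CliffordAlgebra.contractLeft_ι_mul _ a b

theorem contract_one (φ : Module.Dual ℂ (Fin n → ℂ)) :
    contract φ (1 : ExteriorAlgebra ℂ (Fin n → ℂ)) = 0 :=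
  CliffordAlgebra.contractLeft_one _ φ

/-- A nonzero `k`-vector is annihilated by at most `k` linearly independent vectors. -/
theorem eq_zero_of_ι_mul_eq_zero {k r : ℕ} (hkr : k < r) {x : Fin r → Fin n → ℂ}
    (hx : LinearIndependent ℂ x) {η : ExteriorAlgebra ℂ (Fin n → ℂ)}
    (hη : η ∈ ⋀[ℂ]^k (Fin n → ℂ)) (h : ∀ i, ExteriorAlgebra.ι ℂ (x i) * η = 0) : η = 0 := by
  induction k generalizing r η with
  | zero =>
    rw [ExteriorAlgebra.exteriorPower, pow_zero] at hη
    obtain ⟨c, rfl⟩ := Submodule.mem_one.mp hη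
    have h0 := h ⟨0, hkr⟩
    rw [← Algebra.commutes, ← Algebra.smul_def, smul_eq_zero] at h0
    rcases h0 with h0 | h0
    · rw [h0, map_zero]
    · exact absurd ((ExteriorAlgebra.ι_eq_zero_iff _).mp h0) (hx.ne_zero _)
  | succ k ih =>
    obtain ⟨r, rfl⟩ : ∃ r', r = r' + 1 := ⟨r - 1, by omega⟩
    obtain ⟨htail, hnot⟩ := linearIndependent_finSucc.mp hx
    -- The form φ vanishes on the tail but not on x 0. Contracting η with φ lowers its degree and
    -- keeps it annihilated by the tail, so the contraction is zero by induction; the relation for x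
    -- 0 then reads φ (x 0) • η = 0.
    obtain ⟨φ, hφ, hker⟩ := Submodule.exists_le_ker_of_notMem hnot
    have hstep : ∀ i, ExteriorAlgebra.ι ℂ (x i) * contract φ η = φ (x i) • η := fun i => by
      have := contract_ι_mul φ (x i) η
      rw [h i, map_zero] at this
      exact (sub_eq_zero.mp this.symm).symm
    have hzero : contract φ η = 0 := by
      refine ih (by omega) htail (contractLeft_mem k hη) fun i => ?_
      have hi : φ (Fin.tail x i) = 0 := hker (Submodule.subset_span ⟨i, rfl⟩)
      have := hstep i.succ
      change ExteriorAlgebra.ι ℂ (Fin.tail x i) * contract φ η = φ (Fin.tail x i) • η at this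
      rw [this, hi, zero_smul]
    have h0 := hstep 0
    rw [hzero, mul_zero] at h0
    exact (smul_eq_zero.mp h0.symm).resolve_left hφ

/-- The two terms in which φ meets the bivector agree by skew-symmetry, which absorbs the factor ½.
-/
theorem contract_bivector_mul {A : Matrix (Fin n) (Fin n) ℂ} (hA : A.transpose = -A)
    (φ : Module.Dual ℂ (Fin n → ℂ)) (y : ExteriorAlgebra ℂ (Fin n → ℂ)) :
    contract φ (bivector A * y) =
      -(ExteriorAlgebra.ι ℂ (A.mulVec fun i => φ (Pi.single i 1)) * y) +
        bivector A * contract φ y := by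
  have hs : ∀ i j, A j i = -A i j := fun i j => congrFun (congrFun hA i) j
  have hterm : ∀ p : Fin n × Fin n, contract φ (ExteriorAlgebra.ι ℂ (Pi.single p.1 (1 : ℂ)) *
      ExteriorAlgebra.ι ℂ (Pi.single p.2 (1 : ℂ)) * y) =
      φ (Pi.single p.1 1) • (ExteriorAlgebra.ι ℂ (Pi.single p.2 (1 : ℂ)) * y) -
      φ (Pi.single p.2 1) • (ExteriorAlgebra.ι ℂ (Pi.single p.1 (1 : ℂ)) * y) +
      ExteriorAlgebra.ι ℂ (Pi.single p.1 (1 : ℂ)) *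
        ExteriorAlgebra.ι ℂ (Pi.single p.2 (1 : ℂ)) * contract φ y := by
    intro p
    rw [mul_assoc, contract_ι_mul, contract_ι_mul, mul_sub, mul_smul_comm, mul_assoc]
    abel
  have hv : ExteriorAlgebra.ι ℂ (A.mulVec fun i => φ (Pi.single i 1)) =
      ∑ i, ∑ j, (A i j * φ (Pi.single j 1)) • ExteriorAlgebra.ι ℂ (Pi.single i (1 : ℂ)) := by
    have : (A.mulVec fun i => φ (Pi.single i 1)) =
        ∑ i, (∑ j, A i j * φ (Pi.single j 1)) • (Pi.single i (1 : ℂ) : Fin n → ℂ) := by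
      conv_lhs => rw [pi_eq_sum_univ' (A.mulVec fun i => φ (Pi.single i 1))]
      refine Finset.sum_congr rfl fun i _ => ?_
      congr 1
    rw [this, map_sum]
    refine Finset.sum_congr rfl fun i _ => ?_
    rw [map_smul, Finset.sum_smul]
  simp only [bivector_apply, smul_mul_assoc, Finset.sum_mul, map_smul, map_sum, hterm, smul_add,
    Finset.sum_add_distrib, hv]
  congr 1
  simp only [smul_sub, Finset.sum_sub_distrib, smul_smul]
  rw [Fintype.sum_prod_type, Fintype.sum_prod_type, Finset.sum_comm, ← smul_sub,
    ← Finset.sum_sub_distrib, Finset.smul_sum, ← Finset.sum_neg_distrib]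
  refine Finset.sum_congr rfl fun i _ => ?_
  rw [← Finset.sum_sub_distrib, Finset.smul_sum, ← Finset.sum_neg_distrib]
  refine Finset.sum_congr rfl fun j _ => ?_
  rw [hs i j, ← sub_smul, smul_smul, ← neg_smul]
  congr 1
  ring

theorem contract_bivector_pow {A : Matrix (Fin n) (Fin n) ℂ} (hA : A.transpose = -A)
    (φ : Module.Dual ℂ (Fin n → ℂ)) (k : ℕ) :
    contract φ (bivector A ^ (k + 1)) = -((k + 1 : ℂ) •
      (ExteriorAlgebra.ι ℂ (A.mulVec fun i => φ (Pi.single i 1)) * bivector A ^ k)) := by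
  induction k with
  | zero =>
    rw [zero_add, pow_one, pow_zero, ← mul_one (bivector A), contract_bivector_mul hA,
      contract_one, mul_zero, add_zero]
    simp
  | succ k ih =>
    rw [pow_succ', contract_bivector_mul hA, ih, mul_neg, mul_smul_comm, ← mul_assoc,
      (commute_bivector_ι A _).eq, mul_assoc, ← pow_succ', ← neg_add]
    congr 1
    push_cast
    rw [add_smul (k + 1 : ℂ) 1, one_smul, add_comm]

/-- If the power j + 1 vanished, contracting it with all φ would show that every vector in the range
of A annihilates the power j. That power has degree 2j < 2m, too small to be nonzero and annihilated
by 2m independent vectors. -/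
theorem bivector_pow_ne_zero {A : Matrix (Fin n) (Fin n) ℂ} (hA : A.transpose = -A) {m : ℕ}
    {x : Fin (2 * m) → Fin n → ℂ} (hx : LinearIndependent ℂ x)
    (hr : ∀ i, x i ∈ LinearMap.range A.mulVecLin) {j : ℕ} (hj : j ≤ m) :
    bivector A ^ j ≠ 0 := by
  induction j with
  | zero => rw [pow_zero]; exact one_ne_zero
  | succ j ih =>
    intro h0
    refine ih (by omega) (eq_zero_of_ι_mul_eq_zero (by omega) hx (bivector_pow_mem A j) fun i => ?_)
    obtain ⟨z, hz⟩ := hr i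
    -- The form taking e_i to z i makes the contracted vector A z, that is, x i.
    have h := contract_bivector_pow hA (Fintype.linearCombination ℂ z) j
    rw [h0, map_zero] at h
    have hz' : (A.mulVec fun i => Fintype.linearCombination ℂ z (Pi.single i 1)) = x i := by
      rw [← hz, Matrix.mulVecLin_apply]
      congr 1
      funext i
      simp [Fintype.linearCombination_apply_single]
    rw [hz', eq_comm, neg_eq_zero, smul_eq_zero] at h
    exact h.resolve_left (by exact_mod_cast Nat.succ_ne_zero j)

theorem degProj_alpha_ne_zero {A : Matrix (Fin n) (Fin n) ℂ} (hA : A.transpose = -A) {m : ℕ}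
    (hm : m ≤ n) {x : Fin (2 * m) → Fin n → ℂ} (hx : LinearIndependent ℂ x)
    (hr : ∀ i, x i ∈ LinearMap.range A.mulVecLin) : degProj n m (alpha A) ≠ 0 := by
  intro h
  rw [degProj_alpha A m hm, vacuum, wedge_pow_toHalf, mul_one, smul_eq_zero] at h
  have h0 : toHalf n (bivector A ^ m) = 0 :=
    h.resolve_left (inv_ne_zero (by exact_mod_cast m.factorial_ne_zero))
  refine bivector_pow_ne_zero hA hx hr le_rfl ((extBasis n).repr.map_eq_zero_iff.mp ?_)
  ext I
  by_cases hI : I.card = 2 * m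
  · exact congrFun h0 ⟨I, by rw [hI]; exact even_two_mul m⟩
  · exact extBasis_repr_of_mem (bivector_pow_mem A m) hI

theorem degProj_alpha_ne_zero_of_rank {A : Matrix (Fin n) (Fin n) ℂ} (hA : A.transpose = -A)
    (hr : A.rank = 2 * (n / 2)) : degProj n (n / 2) (alpha A) ≠ 0 := by
  have b := (Module.finBasisOfFinrankEq ℂ (LinearMap.range A.mulVecLin) hr)
  exact degProj_alpha_ne_zero hA (Nat.div_le_self _ _)
    (b.linearIndependent.map' _ (Submodule.ker_subtype _)) fun i => (b i).2

/-- A skew-symmetric matrix of maximal rank: the block diagonal one. -/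
def blockMatrix (n : ℕ) : Matrix (Fin n) (Fin n) ℂ := Matrix.of fun i j =>
  if (i : ℕ) % 2 = 0 ∧ (j : ℕ) = i + 1 then 1
  else if (j : ℕ) % 2 = 0 ∧ (i : ℕ) = j + 1 then -1 else 0

theorem blockMatrix_transpose : (blockMatrix n).transpose = -blockMatrix n := by
  ext i j
  simp only [blockMatrix, Matrix.transpose_apply, Matrix.of_apply, Matrix.neg_apply]
  split_ifs <;> first | omega | simp

theorem degProj_alpha_blockMatrix_ne_zero :
    degProj n (n / 2) (alpha (blockMatrix n)) ≠ 0 := by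
  have hle : 2 * (n / 2) ≤ n := Nat.mul_div_le n 2
  refine degProj_alpha_ne_zero blockMatrix_transpose (Nat.div_le_self _ _)
    (x := fun a => Pi.single (Fin.castLE hle a) 1)
    ((Pi.basisFun ℂ (Fin n)).linearIndependent.comp _ (Fin.castLE_injective hle)
      |> fun h => by simpa [Function.comp_def] using h) fun a => ?_
  by_cases ha : (a : ℕ) % 2 = 0
  · refine ⟨Pi.single ⟨a + 1, by omega⟩ 1, ?_⟩
    rw [Matrix.mulVecLin_apply, Matrix.mulVec_single_one]
    ext i
    simp only [blockMatrix, Matrix.col_apply, Matrix.of_apply, Pi.single_apply, Fin.ext_iff,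
      Fin.val_castLE]
    split_ifs <;> first | omega | rfl
  · refine ⟨-Pi.single ⟨a - 1, by omega⟩ 1, ?_⟩
    rw [map_neg, Matrix.mulVecLin_apply, Matrix.mulVec_single_one]
    ext i
    simp only [blockMatrix, Matrix.col_apply, Matrix.of_apply, Pi.single_apply, Fin.ext_iff,
      Fin.val_castLE, Pi.neg_apply]
    split_ifs <;> first | omega | simp

end Nonvanishing

/-! ### Rational normal curves and substitution in binary forms -/

section RationalNormalCurves

variable {E : Type*} [NormedAddCommGroup E] [NormedSpace ℂ E]

/-- The vector of binary forms with coefficients `c`. -/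
def binaryForm {d : ℕ} (c : Fin (d + 1) → E) (v : Fin 2 → ℂ) : E :=
  ∑ j : Fin (d + 1), (v 0 ^ (d - (j : ℕ)) * v 1 ^ (j : ℕ)) • c j

theorem binaryForm_ne_zero {d : ℕ} {c : Fin (d + 1) → E} (hc : LinearIndependent ℂ c)
    {v : Fin 2 → ℂ} (hv : v ≠ 0) : binaryForm c v ≠ 0 := by
  intro h
  have hz := Fintype.linearIndependent_iff.mp hc _ h
  have h0 := hz 0
  have h1 := hz (Fin.last d)
  simp only [Fin.val_zero, Nat.sub_zero, pow_zero, mul_one, Fin.val_last, Nat.sub_self,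
    one_mul] at h0 h1
  refine hv (funext fun i => ?_)
  fin_cases i
  · exact eq_zero_of_pow_eq_zero h0
  · exact eq_zero_of_pow_eq_zero h1

theorem binaryForm_smul {d : ℕ} (c : Fin (d + 1) → E) (a : ℂ) (v : Fin 2 → ℂ) :
    binaryForm c (a • v) = a ^ d • binaryForm c v := by
  rw [binaryForm, binaryForm, Finset.smul_sum]
  refine Finset.sum_congr rfl fun j _ => ?_
  rw [smul_smul, Pi.smul_apply, Pi.smul_apply, smul_eq_mul, smul_eq_mul, mul_pow, mul_pow]
  have : a ^ d = a ^ (d - (j : ℕ)) * a ^ (j : ℕ) := by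
    rw [← pow_add, Nat.sub_add_cancel (Nat.lt_succ_iff.mp j.2)]
  rw [this]
  ring_nf

theorem mk_congr {x y : E} (h : x = y) (hx : x ≠ 0) (hy : y ≠ 0) :
    Projectivization.mk ℂ x hx = Projectivization.mk ℂ y hy := by
  subst h
  rfl

theorem mk_eq_of_eq_smul {x y : E} {a : ℂ} (h : x = a • y) (hx : x ≠ 0) (hy : y ≠ 0) :
    Projectivization.mk ℂ x hx = Projectivization.mk ℂ y hy :=
  (Projectivization.mk_eq_mk_iff' ℂ x y hx hy).mpr ⟨a, h.symm⟩

theorem exists_isRationalNormalCurve {d : ℕ} {c : Fin (d + 1) → E} (hc : LinearIndependent ℂ c) :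
    ∃ γ : P1 → ℙ ℂ E, IsRationalNormalCurve d γ ∧ ∀ (v : Fin 2 → ℂ) (hv : v ≠ 0),
      γ (Projectivization.mk ℂ v hv) = Projectivization.mk ℂ _ (binaryForm_ne_zero hc hv) := by
  set γ : P1 → ℙ ℂ E := fun P => Projectivization.mk ℂ _ (binaryForm_ne_zero hc P.rep_nonzero)
  have hγ : ∀ (v : Fin 2 → ℂ) (hv : v ≠ 0),
      γ (Projectivization.mk ℂ v hv) = Projectivization.mk ℂ _ (binaryForm_ne_zero hc hv) := by
    intro v hv
    obtain ⟨a, ha⟩ := Projectivization.exists_smul_eq_mk_rep ℂ v hv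
    refine mk_eq_of_eq_smul (a := (a : ℂ) ^ d) ?_ _ _
    rw [← ha, Units.smul_def, binaryForm_smul]
  refine ⟨γ, ⟨c, hc, fun v hv => ?_⟩, hγ⟩
  rw [hγ, Projectivization.submodule_mk]
  rfl

/-- The matrix of the substitution `x ↦ x + c y` in binary forms of degree `d`. -/
def shiftMatrix (d : ℕ) (c : ℂ) : Matrix (Fin (d + 1)) (Fin (d + 1)) ℂ := Matrix.of fun i j =>
  if j ≤ i then ((d - (j : ℕ)).choose ((i : ℕ) - j) : ℂ) * c ^ ((i : ℕ) - j) else 0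

theorem det_shiftMatrix (d : ℕ) (c : ℂ) : (shiftMatrix d c).det = 1 := by
  rw [Matrix.det_of_isLowerTriangular]
  · simp [shiftMatrix]
  · intro i j hij
    have : ¬ j ≤ i := not_le.mpr hij
    simp [shiftMatrix, this]

/-- The binomial expansion of (x + c y)^(d - j), times y^j; rows i < j contribute nothing. -/
theorem sum_shiftMatrix {d : ℕ} (c x y : ℂ) (j : Fin (d + 1)) :
    ∑ i : Fin (d + 1), (x ^ (d - (i : ℕ)) * y ^ (i : ℕ)) * shiftMatrix d c i j =
      (x + c * y) ^ (d - (j : ℕ)) * y ^ (j : ℕ) := by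
  obtain ⟨j, hj⟩ := j
  have h1 : ∑ i : Fin (d + 1), (x ^ (d - (i : ℕ)) * y ^ (i : ℕ)) *
      shiftMatrix d c i ⟨j, hj⟩ = ∑ i ∈ Finset.range (d + 1), (x ^ (d - i) * y ^ i) *
        if j ≤ i then ((d - j).choose (i - j) : ℂ) * c ^ (i - j) else 0 := by
    rw [Finset.sum_range]
    rfl
  obtain ⟨e, rfl⟩ : ∃ e, d = j + e := ⟨d - j, by omega⟩
  rw [h1]
  change _ = (x + c * y) ^ (j + e - j) * y ^ j
  rw [add_assoc, Finset.sum_range_add, Finset.sum_eq_zero, zero_add, add_comm x, add_pow,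
    Nat.add_sub_cancel_left, Finset.sum_mul]
  · refine Finset.sum_congr rfl fun l hl => ?_
    rw [if_pos (Nat.le_add_right _ _), Nat.add_sub_cancel_left, Nat.add_sub_add_left, mul_pow,
      pow_add]
    ring
  · intro i hi
    rw [if_neg (by simpa using hi), mul_zero]

end RationalNormalCurves

/-! ### The curves, their osculating limits and general pairs -/

section Curve

variable {n : ℕ}

theorem alpha_smul_eq_sum (r : ℂ) (A : Matrix (Fin n) (Fin n) ℂ) :
    alpha (r • A) = ∑ j : Fin (n / 2 + 1), r ^ (j : ℕ) • degProj n j (alpha A) := by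
  rw [← sum_degProj (alpha (r • A)) (N := n / 2 + 1) (by omega), Finset.sum_range]
  refine Finset.sum_congr rfl fun j _ => ?_
  ext I
  rw [degProj_apply, Pi.smul_apply, degProj_apply]
  split_ifs with h
  · rw [alpha_smul, smul_eq_mul, h, Nat.mul_div_cancel_left _ two_pos]
  · rw [smul_zero]

/-- The coefficients of the binary form `(x + c y) ^ ⌊n/2⌋ • alpha (B + y / (x + c y) • A)`. -/
def curveCoeff (A B : Matrix (Fin n) (Fin n) ℂ) (c : ℂ) (i : Fin (n / 2 + 1)) : HalfSpin n :=
  ∑ j : Fin (n / 2 + 1), shiftMatrix (n / 2) c i j • translation B (degProj n j (alpha A))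

/-- The pieces lie in different degrees, so it suffices that each is nonzero; a vanishing power of
the wedge operator on the vacuum would force the top power to vanish. -/
theorem linearIndependent_degProj_alpha {A : Matrix (Fin n) (Fin n) ℂ}
    (hA : degProj n (n / 2) (alpha A) ≠ 0) :
    LinearIndependent ℂ fun j : Fin (n / 2 + 1) => degProj n j (alpha A) := by
  have hne : ∀ j : Fin (n / 2 + 1), degProj n j (alpha A) ≠ 0 := by
    intro j h
    have hj : (j : ℕ) ≤ n / 2 := Nat.lt_succ_iff.mp j.2
    apply hA
    rw [degProj_alpha A _ (by omega), smul_eq_zero] at h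
    rw [degProj_alpha A _ (by omega)]
    have h0 := h.resolve_left (inv_ne_zero (by exact_mod_cast Nat.factorial_ne_zero _))
    rw [← Nat.sub_add_cancel hj, pow_add, Module.End.mul_apply, h0, map_zero, smul_zero]
  rw [Fintype.linearIndependent_iff]
  intro a ha i
  have := congrArg (degProj n i) ha
  rw [map_sum, map_zero, Finset.sum_eq_single i] at this
  · rw [map_smul, degProj_degProj, if_pos rfl] at this
    exact (smul_eq_zero.mp this).resolve_right (hne i)
  · intro j _ hj
    rw [map_smul, degProj_degProj, if_neg (fun h => hj (Fin.ext h.symm)), smul_zero]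
  · simp

theorem linearIndependent_curveCoeff {A : Matrix (Fin n) (Fin n) ℂ}
    (hA : degProj n (n / 2) (alpha A) ≠ 0) (B : Matrix (Fin n) (Fin n) ℂ) (c : ℂ) :
    LinearIndependent ℂ (curveCoeff A B c) := by
  have hw : LinearIndependent ℂ fun j : Fin (n / 2 + 1) => translation B (degProj n j (alpha A)) :=
    (linearIndependent_degProj_alpha hA).map' (translation B)
      (LinearMap.ker_eq_bot.mpr (translation_injective B))
  rw [Fintype.linearIndependent_iff]
  intro a ha
  have h : Matrix.vecMul a (shiftMatrix (n / 2) c) = 0 := by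
    funext j
    refine Fintype.linearIndependent_iff.mp hw _ ?_ j
    rw [← ha]
    simp only [curveCoeff, Finset.smul_sum, smul_smul, Matrix.vecMul, dotProduct, Finset.sum_smul]
    exact Finset.sum_comm
  exact congrFun (Matrix.eq_zero_of_vecMul_eq_zero
    (by rw [det_shiftMatrix]; exact one_ne_zero) h)

theorem binaryForm_curveCoeff (A B : Matrix (Fin n) (Fin n) ℂ) (c : ℂ) (v : Fin 2 → ℂ)
    (hv : v 0 + c * v 1 ≠ 0) :
    binaryForm (curveCoeff A B c) v =
      (v 0 + c * v 1) ^ (n / 2) • alpha (B + (v 1 / (v 0 + c * v 1)) • A) := by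
  rw [alpha_add, alpha_smul_eq_sum, map_sum, Finset.smul_sum]
  simp only [binaryForm, curveCoeff, Finset.smul_sum, smul_smul]
  rw [Finset.sum_comm]
  refine Finset.sum_congr rfl fun j _ => ?_
  rw [← Finset.sum_smul, sum_shiftMatrix, map_smul, smul_smul]
  congr 1
  have : (v 0 + c * v 1) ^ (n / 2) =
      (v 0 + c * v 1) ^ (n / 2 - (j : ℕ)) * (v 0 + c * v 1) ^ (j : ℕ) := by
    rw [← pow_add, Nat.sub_add_cancel (Nat.lt_succ_iff.mp j.2)]
  rw [this, div_pow]
  field_simp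

theorem continuous_binaryForm {E : Type*} [NormedAddCommGroup E] [NormedSpace ℂ E] {d : ℕ}
    (c : Fin (d + 1) → E) : Continuous (binaryForm c) := by
  unfold binaryForm
  fun_prop

/-- The curve leaves the affine chart where v 0 + c v 1 = 0. There each equation holds by
continuity, after perturbing the first coordinate of v. -/
theorem mk_binaryForm_curveCoeff_mem {A B : Matrix (Fin n) (Fin n) ℂ} (hA : A.transpose = -A)
    (hB : B.transpose = -B) (c : ℂ) (v : Fin 2 → ℂ) (hv : binaryForm (curveCoeff A B c) v ≠ 0) :
    Projectivization.mk ℂ _ hv ∈ spinorVariety n := by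
  rw [mk_mem_spinorVariety_iff]
  intro d F hF hvan
  set G : ℂ → ℂ := fun s =>
    MvPolynomial.eval (binaryForm (curveCoeff A B c) (v + s • ![1, 0])) F with hG
  have hGc : Continuous G := by
    refine (MvPolynomial.continuous_eval F).comp ((continuous_binaryForm _).comp ?_)
    fun_prop
  have hG0 : G 0 = 0 := by
    refine tendsto_nhds_unique (hGc.continuousAt.tendsto.mono_left
      (nhdsWithin_le_nhds (s := {0}ᶜ))) (tendsto_const_nhds.congr' ?_)
    have hfin := Filter.le_cofinite_iff_eventually_ne.mp (nhdsNE_le_cofinite 0) (-(v 0 + c * v 1))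
    filter_upwards [hfin] with s hs
    have hne : (v + s • ![1, 0] : Fin 2 → ℂ) 0 + c * (v + s • ![1, 0] : Fin 2 → ℂ) 1 ≠ 0 := fun h => hs (by
      simp at h
      linear_combination h)
    rw [hG]
    simp only
    rw [binaryForm_curveCoeff A B c _ hne, hF.eval_smul,
      hvan _ (skew_add hB (skew_smul hA _)), mul_zero]
  have he : G 0 = MvPolynomial.eval (binaryForm (curveCoeff A B c) v) F := by
    rw [hG]
    simp only [zero_smul, add_zero]
  rw [← he, hG0]

/-- The common factor `translation B` comes out, so the limit only has to be computed at the vacuum.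
-/
theorem osculatingFamily_eq {A B : Matrix (Fin n) (Fin n) ℂ} (hA : A.transpose = -A)
    (hB : B.transpose = -B) {r : ℂ} {γ : P1 → ℙ ℂ (HalfSpin n)} {t : ℂ}
    (hγ : γ (P1.ofAffine t) = Projectivization.mk ℂ (alpha (B + r • A)) (alpha_ne_zero _))
    (s₁ s₂ : ℕ) :
    osculatingFamily (spinorVariety n) (Projectivization.mk ℂ (alpha B) (alpha_ne_zero B)) γ
      s₁ s₂ t =
      (wedgeSpan n s₁ ⊔ (wedgeSpan n s₂).map (translation (r • A))).map (translation B) := by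
  rw [osculatingFamily, hγ, osculatingSpace_alpha hB,
    osculatingSpace_alpha (skew_add hB (skew_smul hA r)), Submodule.map_sup, translation_add,
    ← Submodule.map_comp]
  rfl

theorem eventually_one_add_mul_ne_zero (c : ℂ) : ∀ᶠ t : ℂ in Filter.cofinite, 1 + c * t ≠ 0 := by
  by_cases hc : c = 0
  · simp [hc]
  · filter_upwards [(Set.finite_singleton (-c⁻¹)).compl_mem_cofinite] with t ht h
    refine ht ?_
    rw [Set.mem_singleton_iff]
    field_simp
    linear_combination h

/-- A polynomial vector proportional to `translation (B + t / (1 + c t) • A) v`. -/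
def translationPoly (A B : Matrix (Fin n) (Fin n) ℂ) (c : ℂ) (v : HalfSpin n) (I : EvenSubset n) :
    Polynomial ℂ :=
  ∑ k ∈ Finset.range (n + 1),
    Polynomial.C (translation B ((k.factorial : ℂ)⁻¹ • (wedge A ^ k) v) I) *
      (Polynomial.X ^ k * (1 + Polynomial.C c * Polynomial.X) ^ (n - k))

/-- The exponential has order at most n in t / (1 + c t), so the n-th power of 1 + c t clears
denominators. -/
theorem evalVec_translationPoly (A B : Matrix (Fin n) (Fin n) ℂ) {c t : ℂ} (ht : 1 + c * t ≠ 0)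
    (v : HalfSpin n) :
    evalVec t (translationPoly A B c v) =
      (1 + c * t) ^ n • translation B (translation ((t / (1 + c * t)) • A) v) := by
  ext I
  change (∑ k ∈ Finset.range (n + 1),
    Polynomial.C (translation B ((k.factorial : ℂ)⁻¹ • (wedge A ^ k) v) I) *
      (Polynomial.X ^ k * (1 + Polynomial.C c * Polynomial.X) ^ (n - k))).eval t = _
  rw [Polynomial.eval_finsetSum, translation_apply (_ • A),
    map_sum, Pi.smul_apply, Finset.sum_apply, Finset.smul_sum]
  refine Finset.sum_congr rfl fun k hk => ?_
  have hkn : k ≤ n := by simp at hk; omega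
  rw [map_smul wedge, smul_pow, LinearMap.smul_apply]
  simp only [map_smul, Pi.smul_apply, Polynomial.eval_mul, Polynomial.eval_C, Polynomial.eval_pow, Polynomial.eval_X,
    Polynomial.eval_add, Polynomial.eval_one, smul_eq_mul]
  have : (1 + c * t) ^ n = (1 + c * t) ^ (n - k) * (1 + c * t) ^ k := by
    rw [← pow_add, Nat.sub_add_cancel hkn]
  rw [this, div_pow]
  field_simp

theorem hasOsculatingLimits_of_eq_alpha {A B : Matrix (Fin n) (Fin n) ℂ} (hA : A.transpose = -A)
    (hB : B.transpose = -B) {c : ℂ} {γ : P1 → ℙ ℂ (HalfSpin n)}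
    (hγ : ∀ t : ℂ, 1 + c * t ≠ 0 → γ (P1.ofAffine t) =
      Projectivization.mk ℂ (alpha (B + (t / (1 + c * t)) • A)) (alpha_ne_zero _)) :
    HasOsculatingLimits (spinorVariety n) γ := by
  have h0 : γ (P1.ofAffine 0) = Projectivization.mk ℂ (alpha B) (alpha_ne_zero B) := by
    rw [hγ 0 (by simp)]
    exact mk_congr (by simp) _ _
  intro s₁ s₂
  rw [h0]
  constructor
  · refine exists_isFlatLimit (κ := wedgeSpan n s₁ ⊕ wedgeSpan n s₂)
      (Sum.elim (fun u I => Polynomial.C (translation B u I))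
        fun v => translationPoly A B c v) ?_
    filter_upwards [eventually_one_add_mul_ne_zero c] with t ht
    rw [osculatingFamily_eq hA hB (hγ t ht)]
    apply le_antisymm
    · rw [Submodule.span_le]
      rintro _ ⟨u | v, rfl⟩
      · refine ⟨u, Submodule.mem_sup_left u.2, ?_⟩
        ext I
        simp [evalVec_apply]
      · simp only [Sum.elim_inr]
        rw [evalVec_translationPoly A B ht]
        exact Submodule.smul_mem _ _
          ⟨_, Submodule.mem_sup_right ⟨v, v.2, rfl⟩, rfl⟩
    · rw [Submodule.map_sup]
      refine sup_le ?_ ?_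
      · rintro _ ⟨u, hu, rfl⟩
        refine Submodule.subset_span ⟨Sum.inl ⟨u, hu⟩, ?_⟩
        ext I
        simp [evalVec_apply]
      · rintro _ ⟨_, ⟨v, hv, rfl⟩, rfl⟩
        have h1 := Submodule.smul_mem (Submodule.span ℂ (Set.range fun j => evalVec t
          (Sum.elim (fun (u : wedgeSpan n s₁) I => Polynomial.C (translation B u I))
            (fun v : wedgeSpan n s₂ => translationPoly A B c v) j))) ((1 + c * t) ^ n)⁻¹
          (Submodule.subset_span ⟨Sum.inr ⟨v, hv⟩, rfl⟩)
        simp only [Sum.elim_inr] at h1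
        rwa [evalVec_translationPoly A B ht, inv_smul_smul₀ (pow_ne_zero _ ht)] at h1
  · intro T₀ hT₀
    rw [osculatingSpace_alpha hB]
    refine hT₀.le_of_forall fun y hy hyT => ?_
    have hcont : Continuous (translation (-B)) := LinearMap.continuous_of_finiteDimensional _
    have hr : ContinuousAt (fun t : ℂ => t / (1 + c * t)) 0 := by
      refine ContinuousAt.div continuousAt_id (by fun_prop) (by simp)
    have hne : ∀ᶠ t : ℂ in 𝓝[≠] 0, 1 + c * t ≠ 0 := by
      refine nhdsWithin_le_nhds ?_
      have : ContinuousAt (fun t : ℂ => 1 + c * t) 0 := by fun_prop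
      exact this.eventually_ne (by simp)
    have hmem := mem_wedgeSpan_of_eventually hA (s₁ := s₁) (s₂ := s₂)
      (y := fun t => translation (-B) (y t)) (hcont.comp hy).continuousAt hr (by simp) (by
        filter_upwards [hyT, hne] with t hyt ht
        rw [osculatingFamily_eq hA hB (hγ t ht)] at hyt
        obtain ⟨x, hx, hxy⟩ := hyt
        rw [← hxy, translation_neg_apply]
        exact hx)
    refine ⟨_, hmem, ?_⟩
    have := translation_neg_apply (-B) (y 0)
    rwa [neg_neg] at this

/-- The curve `t ↦ [alpha (B + t / (1 + c t) • A)]` is a rational normal curve in the Spinor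
variety, along which the osculating spaces have the expected limits. -/
theorem exists_curve {A B : Matrix (Fin n) (Fin n) ℂ} (hA : A.transpose = -A)
    (hB : B.transpose = -B) (hm : degProj n (n / 2) (alpha A) ≠ 0) (c : ℂ) :
    ∃ γ : P1 → ℙ ℂ (HalfSpin n), IsRationalNormalCurve (n / 2) γ ∧
      (∀ x, γ x ∈ spinorVariety n) ∧
      (∀ t : ℂ, 1 + c * t ≠ 0 → γ (P1.ofAffine t) =
        Projectivization.mk ℂ (alpha (B + (t / (1 + c * t)) • A)) (alpha_ne_zero _)) ∧
      (c ≠ 0 → γ P1.infty =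
        Projectivization.mk ℂ (alpha (B + c⁻¹ • A)) (alpha_ne_zero _)) ∧
      HasOsculatingLimits (spinorVariety n) γ := by
  obtain ⟨γ, hrnc, hγ⟩ := exists_isRationalNormalCurve (linearIndependent_curveCoeff hm B c)
  have hval : ∀ (v : Fin 2 → ℂ) (hv : v ≠ 0), v 0 + c * v 1 ≠ 0 →
      γ (Projectivization.mk ℂ v hv) = Projectivization.mk ℂ
        (alpha (B + (v 1 / (v 0 + c * v 1)) • A)) (alpha_ne_zero _) := fun v hv h => by
    rw [hγ v hv]
    exact mk_eq_of_eq_smul (binaryForm_curveCoeff A B c v h) _ _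
  have haff : ∀ t : ℂ, 1 + c * t ≠ 0 → γ (P1.ofAffine t) =
      Projectivization.mk ℂ (alpha (B + (t / (1 + c * t)) • A)) (alpha_ne_zero _) := fun t ht =>
    hval ![1, t] _ (by simpa using ht)
  refine ⟨γ, hrnc, fun P => ?_, haff, fun hc => ?_, hasOsculatingLimits_of_eq_alpha hA hB haff⟩
  · induction P using Projectivization.ind with
    | h v hv =>
      rw [hγ v hv]
      exact mk_binaryForm_curveCoeff_mem hA hB c v _
  · rw [P1.infty, hval _ _ (by simpa using hc)]
    exact mk_congr (by simp) _ _

/-- The bihomogeneous polynomial whose nonvanishing defines general pairs of points. -/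
def generalPairPoly (I : EvenSubset n) : MvPolynomial (EvenSubset n ⊕ EvenSubset n) ℂ :=
  MvPolynomial.X (Sum.inl (emptyIndex n)) * MvPolynomial.X (Sum.inr (emptyIndex n)) *
    MvPolynomial.aeval (fun p => MvPolynomial.X (Sum.inl (emptyIndex n)) *
      MvPolynomial.rename Sum.inr (skewEntry p) - MvPolynomial.X (Sum.inr (emptyIndex n)) *
      MvPolynomial.rename Sum.inl (skewEntry p)) (pfaffianPoly I)

theorem eval_generalPairPoly (I : EvenSubset n) (x y : HalfSpin n) :
    MvPolynomial.eval (Sum.elim x y) (generalPairPoly I) =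
      x (emptyIndex n) * y (emptyIndex n) *
        alpha (x (emptyIndex n) • skewOf y - y (emptyIndex n) • skewOf x) I := by
  rw [generalPairPoly, map_mul, map_mul, eval_aeval_pfaffianPoly, MvPolynomial.eval_X,
    MvPolynomial.eval_X]
  congr 2
  ext i j
  simp [MvPolynomial.eval_rename, Function.comp_def, eval_skewEntry]

theorem hasStrongTwoOsculatingRegularity_spinorVariety (n : ℕ) :
    HasStrongTwoOsculatingRegularity (n / 2) (spinorVariety n) := by
  -- A principal Pfaffian of size 2⌊n/2⌋ that is nonzero for the block matrix; it defines the open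
  -- set of general pairs.
  obtain ⟨I, hI⟩ := Function.ne_iff.mp (degProj_alpha_blockMatrix_ne_zero (n := n))
  rw [degProj_apply, Pi.zero_apply] at hI
  have hcard : I.1.card = 2 * (n / 2) := by
    by_contra h
    exact hI (if_neg h)
  rw [if_pos hcard] at hI
  have hz : (0 : Matrix (Fin n) (Fin n) ℂ).transpose = -0 := by simp
  refine ⟨generalPairPoly I, ⟨alpha 0, ⟨alpha_ne_zero _, mk_alpha_mem hz⟩, alpha (blockMatrix n),
    ⟨alpha_ne_zero _, mk_alpha_mem blockMatrix_transpose⟩, ?_⟩, ?_⟩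
  · have e : ∀ A : Matrix (Fin n) (Fin n) ℂ, alpha A (emptyIndex n) = 1 := alpha_empty
    rw [eval_generalPairPoly, e, e, skewOf_alpha hz, skewOf_alpha blockMatrix_transpose]
    simpa using hI
  · intro x y hx hy hxX hyX hF
    rw [eval_generalPairPoly] at hF
    have hx0 : x (emptyIndex n) ≠ 0 := fun h => hF (by simp [h])
    have hy0 : y (emptyIndex n) ≠ 0 := fun h => hF (by simp [h])
    set a := x (emptyIndex n)
    set b := y (emptyIndex n)
    set B := a⁻¹ • skewOf x with hBdef
    set C := b⁻¹ • skewOf y with hCdef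
    have hB : B.transpose = -B := skew_smul (skewOf_transpose x) _
    have hC : C.transpose = -C := skew_smul (skewOf_transpose y) _
    have hCB : (C - B).transpose = -(C - B) := (skewSubmodule n).sub_mem (x := C) hC hB
    -- The matrix tested by `generalPairPoly` is a nonzero multiple of C - B, so the polynomial
    -- controls the top-degree part of alpha (C - B).
    have hdiff : C - B = (a * b)⁻¹ • (a • skewOf y - b • skewOf x) := by
      rw [smul_sub, smul_smul, smul_smul, hBdef, hCdef]
      congr 2 <;> field_simp
    have hm : degProj n (n / 2) (alpha (C - B)) ≠ 0 := by
      refine fun h => hF ?_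
      have h1 := congrFun h I
      rw [degProj_apply, if_pos hcard, hdiff, alpha_smul, Pi.zero_apply] at h1
      rw [(mul_eq_zero.mp h1).resolve_left (pow_ne_zero _ (inv_ne_zero (mul_ne_zero hx0 hy0))),
        mul_zero]
    -- With c = 1 the parameter t / (1 + t) is 0 at t = 0 and 1 at ∞, so the curve runs from B to B
    -- + (C - B) = C.
    obtain ⟨γ, h1, h2, h3, h4, h5⟩ := exists_curve hCB hB hm 1
    refine ⟨γ, h1, h2, ?_, ?_, h5⟩
    · rw [h3 0 (by simp), mk_congr (y := alpha B) (by simp) _ (alpha_ne_zero B)]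
      exact (mk_eq_of_eq_smul (eq_smul_alpha_of_mem ⟨hx, hxX⟩ hx0) _ _).symm
    · rw [h4 one_ne_zero, mk_congr (y := alpha C) (by simp) _ (alpha_ne_zero C)]
      exact (mk_eq_of_eq_smul (eq_smul_alpha_of_mem ⟨hy, hyX⟩ hy0) _ _).symm

end Curve

end SpinorVariety

end

/-- The Spinor variety `S_n ⊆ ℙ(Δ)` has strong `2`-osculating regularity, realized by rational
normal curves of degree `⌊n/2⌋`. Moreover, for every skew-symmetric matrix `A` of the maximal
possible rank `2⌊n/2⌋`, the curve `t ↦ alpha (t A)` extends to such a rational normal curve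
`ℙ¹ → S_n`, and the flat limits at `t = 0` are contained in the osculating spaces claimed. -/
theorem mainTheorem8 (n : ℕ) :
    SpinorVariety.HasStrongTwoOsculatingRegularity (n / 2) (SpinorVariety.spinorVariety n) ∧
    ∀ A : Matrix (Fin n) (Fin n) ℂ, A.transpose = -A → A.rank = 2 * (n / 2) →
      ∃ γ : SpinorVariety.P1 → Projectivization ℂ (SpinorVariety.HalfSpin n),
        SpinorVariety.IsRationalNormalCurve (n / 2) γ ∧
        (∀ x, γ x ∈ SpinorVariety.spinorVariety n) ∧
        (∀ t : ℂ, γ (SpinorVariety.P1.ofAffine t) =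
          Projectivization.mk ℂ (SpinorVariety.alpha (t • A)) (SpinorVariety.alpha_ne_zero _)) ∧
        SpinorVariety.HasOsculatingLimits (SpinorVariety.spinorVariety n) γ := by
  refine ⟨SpinorVariety.hasStrongTwoOsculatingRegularity_spinorVariety n, fun A hA hr => ?_⟩
  -- With B = 0 and c = 0 the curve is t ↦ alpha (t • A) for all t.
  obtain ⟨γ, h1, h2, h3, -, h5⟩ := SpinorVariety.exists_curve (B := 0) hA (by simp)
    (SpinorVariety.degProj_alpha_ne_zero_of_rank hA hr) 0
  refine ⟨γ, h1, h2, fun t => ?_, h5⟩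
  rw [h3 t (by simp)]
  exact SpinorVariety.mk_congr (by simp) _ _
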